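/- Sequences $\gamma=(\gamma_1,\gamma_2,\dots)$ of nonnegative integers are assumed to vanish from some point on. The length $l(\gamma)$ is the least $l\ge 0$ with $\gamma_k=0$ for all $k>l$. Write $\gamma\vdash n$ if $\gamma$ is a partition of $n$, i.e. $\gamma_1\ge\gamma_2\ge\cdots$ and $\sum_i\gamma_i=n$, and let $\varepsilon_i$ be the sequence with $1$ in position $i$ and zeros elsewhere. For $\alpha\vdash n$ let $\zeta^\alpha$ be the irreducible complex character of the symmetric group $S_n$ corresponding to $\alpha$, i.e. the character of the Specht module $\mathbb C[S_n]\,c_\alpha$, where $c_\alpha$ is the Young symmetrizer $c_\alpha=\big(\sum_{\sigma\in R}\sigma\big)\big(\sum_{\tau\in C}\operatorname{sgn}(\tau)\,\tau\big)$ and $R$, $C$ are the groups of permutations in $S_n$ that preserve each row, respectively each column, of the tableau of shape $\alpha$ filled with $1,2,\dots,n$ row by row. For $\beta\vdash n$ let $\zeta^\alpha_\beta$ be the value of $\zeta^\alpha$ at the permutations whose cycle lengths are the nonzero parts of $\beta$. **Theorem.** Let $n\ge 1$, let $\alpha,\beta\vdash n$, and put $m=l(\beta)$. (i) If $\beta_m=1$,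 then $$\zeta^\alpha_\beta=\sum_{\substack{1\le i\le l(\alpha)\\ \alpha_i>\alpha_{i+1}}}\zeta^{\alpha-\varepsilon_i}_{\beta-\varepsilon_m}.$$ (ii) If $\beta_m\neq 1$, then $$\zeta^\alpha_\beta=(\beta_m-1)^{-1}\Bigg[\sum_{\substack{1\le i\le l(\alpha)\\ \alpha_i>\alpha_{i+1}}}(\alpha_i-i)\,\zeta^{\alpha-\varepsilon_i}_{\beta-\varepsilon_m}-\sum_{\substack{1\le j\le m-1\\ \beta_j<\beta_{j-1}}}\mu_j\,\beta_j\,\zeta^\alpha_{\beta+\varepsilon_j-\varepsilon_m}\Bigg],$$ where $\beta_0:=\infty$ and $\mu_j=|\{1\le k\le l(\beta-\varepsilon_m) : (\beta-\varepsilon_m)_k=\beta_j\}|$ is the multiplicity of $\beta_j$ in $\beta-\varepsilon_m$. -/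

import Mathlib

/-! Irreducible characters of the symmetric groups. Sequences of nonnegative integers that vanish
from some point on are functions `ℕ →₀ ℕ`. Positions are counted from `0`, so the entry written
`γ_i` with `i = 1, 2, …` in the usual notation is `γ (i - 1)` here. -/

namespace SymChar

/-- `γ ⊢ n`: the sequence `γ` is a partition of `n`. -/
def IsPartition (γ : ℕ →₀ ℕ) (n : ℕ) : Prop :=
  (∀ i, γ (i + 1) ≤ γ i) ∧ γ.degree = n

/-- The length of `γ`: the least `l` such that all entries from position `l` on are zero. -/
noncomputable def len (γ : ℕ →₀ ℕ) : ℕ :=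
  sInf {l | ∀ k, l ≤ k → γ k = 0}

/-- `ε i` has a one in position `i` and zeros elsewhere. -/
noncomputable def ε (i : ℕ) : ℕ →₀ ℕ :=
  Finsupp.single i 1

/-- The sum of the entries of `γ` that come before position `j`. -/
def partialSum (γ : ℕ →₀ ℕ) (j : ℕ) : ℕ :=
  ∑ k ∈ Finset.range j, γ k

/-- The consecutive elements of `Fin n` that make up block number `j` when `Fin n` is cut, from
left to right, into blocks of sizes `γ 0, γ 1, γ 2, …`. -/
def block (n : ℕ) (γ : ℕ →₀ ℕ) (j : ℕ) : List (Fin n) :=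
  (List.finRange n).filter fun k => partialSum γ j ≤ k.val ∧ k.val < partialSum γ (j + 1)

/-- The standard permutation `σ_β` whose cycles are the blocks of `β`, each in increasing order;
for `β = (4,2,2,1)` it is `(1 2 3 4)(5 6)(7 8)(9)`. -/
noncomputable def cyclePerm (n : ℕ) (β : ℕ →₀ ℕ) : Equiv.Perm (Fin n) :=
  ((List.range (len β)).map fun j => (block n β j).formPerm).prod

/-- The row containing `k` in the tableau of shape `α` filled with `0, 1, 2, …` row by row. -/
noncomputable def rowOf (α : ℕ →₀ ℕ) (k : ℕ) : ℕ :=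
  sInf {i | k < partialSum α (i + 1)}

/-- The column containing `k` in the tableau of shape `α` filled with `0, 1, 2, …` row by row. -/
noncomputable def colOf (α : ℕ →₀ ℕ) (k : ℕ) : ℕ :=
  k - partialSum α (rowOf α k)

/-- The row group (Young subgroup) of `α`: the permutations preserving each row. -/
def rowGroup (n : ℕ) (α : ℕ →₀ ℕ) : Subgroup (Equiv.Perm (Fin n)) where
  carrier := {τ | ∀ k, rowOf α (τ k) = rowOf α k}
  mul_mem' {σ τ} hσ hτ k := (hσ (τ k)).trans (hτ k)
  one_mem' _ := rfl
  inv_mem' {τ} hτ k := by simpa using (hτ (τ⁻¹ k)).symm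

/-- The column group of `α`: the permutations preserving each column. -/
def colGroup (n : ℕ) (α : ℕ →₀ ℕ) : Subgroup (Equiv.Perm (Fin n)) where
  carrier := {τ | ∀ k, colOf α (τ k) = colOf α k}
  mul_mem' {σ τ} hσ hτ k := (hσ (τ k)).trans (hτ k)
  one_mem' _ := rfl
  inv_mem' {τ} hτ k := by simpa using (hτ (τ⁻¹ k)).symm

/-- The Young symmetrizer of `α` in the group algebra of the symmetric group: the sum of the
elements of the row group times the signed sum of the elements of the column group. -/
noncomputable def youngSymmetrizer (n : ℕ) (α : ℕ →₀ ℕ) :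
    MonoidAlgebra ℂ (Equiv.Perm (Fin n)) := by
  classical
  exact (∑ τ with τ ∈ rowGroup n α, MonoidAlgebra.single τ 1) *
    (∑ τ with τ ∈ colGroup n α, MonoidAlgebra.single τ ((Equiv.Perm.sign τ : ℤ) : ℂ))

/-- The Specht module of `α`: the left ideal of the group algebra generated by the
Young symmetrizer. -/
noncomputable def spechtModule (n : ℕ) (α : ℕ →₀ ℕ) :
    Ideal (MonoidAlgebra ℂ (Equiv.Perm (Fin n))) :=
  Ideal.span {youngSymmetrizer n α}

/-- `ζ^α`: for `α ⊢ n`, the irreducible character of the symmetric group of degree `n`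
corresponding to `α`, that is, the character of its Specht module. -/
noncomputable def zeta (n : ℕ) (α : ℕ →₀ ℕ) (σ : Equiv.Perm (Fin n)) : ℂ :=
  (Representation.ofModule' (k := ℂ) (G := Equiv.Perm (Fin n)) (spechtModule n α)).character σ

/-- `ζ^α_β`: for `α, β ⊢ n`, the value of `ζ^α` at the conjugacy class corresponding to `β`. -/
noncomputable def zetaVal (n : ℕ) (α β : ℕ →₀ ℕ) : ℂ :=
  zeta n α (cyclePerm n β)

/-- The multiplicity of the `j`-th entry of `γ` among the entries of `γ` before its length. -/
noncomputable def mult (γ : ℕ →₀ ℕ) (j : ℕ) : ℕ :=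
  ((Finset.range (len γ)).filter fun k => γ k = γ j).card

/-- The rows `i` of `α` with `α_i > α_{i+1}`. -/
noncomputable def removableRows (α : ℕ →₀ ℕ) : Finset ℕ :=
  (Finset.range (len α)).filter fun i => α (i + 1) < α i

/-- The positions `j` of `β` before the last part with `β_j < β_{j-1}`, where the entry
before the first one counts as infinite. -/
noncomputable def descentsBeforeLast (β : ℕ →₀ ℕ) : Finset ℕ :=
  (Finset.range (len β - 1)).filter fun j => j = 0 ∨ β j < β (j - 1)

end SymChar

/-! The core is Frobenius' formula: in `L ≥ l(α)` variables, with δ = (L-1, …, 1, 0), Δ the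
Vandermonde product and p_β the product of the power sums of the parts of β, the value ζ^α_β is the
coefficient of x^(α+δ) in Δ p_β (`zetaVal_eq_coeff`).

The recursion follows by putting γ = β - ε_m. If β_m = 1, then p_β = p_1 p_γ. A factor x_i lowers
the exponent sought to (α - ε_i) + δ, and rows with α_i = α_{i+1} contribute nothing: the lowered
exponent has a repeated entry and Δ p_γ is antisymmetric, or the exponent to be lowered is already
0. In general the derivation D = Σ x_i² ∂_i satisfies D p_b = b p_{b+1} and DΔ = (L-1) p_1 Δ. The
coefficient in Δ · D p_γ is Σ_j γ_j ζ^α_{γ+ε_j}, whose term j = m is (β_m - 1) ζ^α_β. The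
coefficient in D(Δ p_γ) - (L-1) p_1 Δ p_γ attaches the factor α_i - i to row i. Solving for ζ^α_β
and collecting equal parts gives (ii).

Frobenius' formula is proved by pairing class functions with the Young symmetrizers c_μ, which
determine them (`eq_zero_of_forall_youngSymmetrizer`). Since c_γ x c_μ = 0 for γ ≠ μ and c_μ x c_μ
is a multiple of c_μ, the character ζ^α takes a nonzero value h at c_α and vanishes at every other
c_μ. For the alternating formula A^α, expanding Δ produces permutation characters on colorings whose
contents dominate α. Such a character kills c_μ unless μ dominates the content, so A^α(c_μ) ≠ 0
forces μ to dominate α, and A^α(c_α) = h.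

Shapes μ strictly above α are excluded by the central sum of all transpositions. It acts on c_μ by a
scalar, and a cut-and-join computation (`vander_mul_cutJoin`, `sum_fixPoly_swap_mul`) makes A^α an
eigenfunction whose eigenvalue is Σ(α_i + δ_i)² up to a common constant. This sum of squares
increases strictly in the dominance order. -/

namespace SymChar

open MvPolynomial

/-! ### Euler operators and the Vandermonde product -/

/-- The Euler operator `X i * ∂ / ∂ X i`. -/
noncomputable def euler {L : ℕ} (i : Fin L) :
    Derivation ℂ (MvPolynomial (Fin L) ℂ) (MvPolynomial (Fin L) ℂ) :=
  (X i : MvPolynomial (Fin L) ℂ) • pderiv i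

theorem euler_X {L : ℕ} (i j : Fin L) :
    euler i (X j : MvPolynomial (Fin L) ℂ) = if j = i then X j else 0 := by
  classical
  simp only [euler, Derivation.smul_apply, pderiv_X, smul_eq_mul, Pi.single_apply]
  split_ifs with h
  · subst h; simp
  · simp

theorem euler_monomial {L : ℕ} (i : Fin L) (a : Fin L →₀ ℕ) (c : ℂ) :
    euler i (monomial a c) = (a i : ℂ) • monomial a c := by
  rw [euler, Derivation.smul_apply, smul_eq_mul, X_mul_pderiv_monomial, ← Nat.cast_smul_eq_nsmul ℂ]

theorem coeff_euler {L : ℕ} (i : Fin L) (a : Fin L →₀ ℕ) (F : MvPolynomial (Fin L) ℂ) :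
    coeff a (euler i F) = (a i : ℂ) * coeff a F := by
  classical
  induction F using MvPolynomial.induction_on' with
  | monomial b c =>
    rw [euler_monomial, coeff_smul, coeff_monomial, smul_eq_mul]
    split_ifs with h
    · rw [h]
    · simp
  | add p q hp hq => rw [map_add, coeff_add, coeff_add, hp, hq, mul_add]

theorem derivation_prod {ι A : Type*} [DecidableEq ι] [CommRing A] [Algebra ℂ A]
    (D : Derivation ℂ A A) (s : Finset ι) (f : ι → A) :
    D (∏ p ∈ s, f p) = ∑ p ∈ s, (∏ q ∈ s.erase p, f q) * D (f p) := by
  induction s using Finset.induction_on with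
  | empty => simp
  | insert a s ha ih =>
    rw [Finset.prod_insert ha, Derivation.leibniz, ih, Finset.sum_insert ha,
      Finset.erase_insert ha, smul_eq_mul, smul_eq_mul, Finset.mul_sum, add_comm]
    congr 1
    refine Finset.sum_congr rfl fun p hp => ?_
    have hpa : a ≠ p := fun h => ha (h ▸ hp)
    rw [Finset.erase_insert_of_ne hpa, Finset.prod_insert (fun h => ha (Finset.mem_of_mem_erase h)),
      mul_assoc]

/-- The increasing pairs of indices. -/
def pairs (L : ℕ) : Finset (Fin L × Fin L) :=
  Finset.univ.filter fun p => p.1 < p.2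

/-- The Vandermonde product `∏ (X i - X j)` over `i < j`. -/
noncomputable def vander (L : ℕ) : MvPolynomial (Fin L) ℂ :=
  ∏ p ∈ pairs L, (X p.1 - X p.2)

/-- The Vandermonde product without the factor that belongs to the pair `p`. -/
noncomputable def vanderErase {L : ℕ} (p : Fin L × Fin L) : MvPolynomial (Fin L) ℂ :=
  ∏ q ∈ (pairs L).erase p, (X q.1 - X q.2)

theorem vanderErase_mul {L : ℕ} {p : Fin L × Fin L} (hp : p ∈ pairs L) :
    vanderErase p * (X p.1 - X p.2) = vander L :=
  Finset.prod_erase_mul _ _ hp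

/-- The projective Vandermonde matrix lists the powers in decreasing order, so the identity
permutation contributes x^δ, δ = (L-1, …, 1, 0), with sign +1. -/
theorem vander_eq_det (L : ℕ) :
    vander L = (Matrix.projVandermonde 1 (X : Fin L → MvPolynomial (Fin L) ℂ)).det := by
  rw [Matrix.det_projVandermonde, vander, pairs, Finset.prod_filter, ← Finset.univ_product_univ,
    Finset.prod_product]
  refine Finset.prod_congr rfl fun i _ => ?_
  rw [← Finset.prod_filter]
  refine Finset.prod_congr (by ext; simp) fun j _ => ?_
  simp

/-- The exponent vector of the monomial of `vander L` indexed by `σ`. -/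
noncomputable def vanderExp {L : ℕ} (σ : Equiv.Perm (Fin L)) : Fin L →₀ ℕ :=
  Finsupp.equivFunOnFinite.symm fun i => ((σ⁻¹ i).rev : ℕ)

theorem vanderExp_apply {L : ℕ} (σ : Equiv.Perm (Fin L)) (i : Fin L) :
    vanderExp σ i = ((σ⁻¹ i).rev : ℕ) := rfl

theorem vander_eq_sum (L : ℕ) :
    vander L = ∑ σ : Equiv.Perm (Fin L), monomial (vanderExp σ) ((Equiv.Perm.sign σ : ℤ) : ℂ) := by
  rw [vander_eq_det, Matrix.det_apply']
  refine Finset.sum_congr rfl fun σ _ => ?_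
  have h : ∀ i : Fin L, Matrix.projVandermonde 1 (X : Fin L → MvPolynomial (Fin L) ℂ) (σ i) i =
      X (σ i) ^ vanderExp σ (σ i) := fun i => by
    rw [vanderExp_apply, Matrix.projVandermonde_apply]; simp
  rw [monomial_eq, Finsupp.prod_fintype _ _ (fun i => by simp)]
  simp only [h]
  rw [Equiv.prod_comp σ (fun i => (X i : MvPolynomial (Fin L) ℂ) ^ vanderExp σ i)]
  simp

theorem rename_vander {L : ℕ} (σ : Equiv.Perm (Fin L)) :
    rename σ (vander L) = ((Equiv.Perm.sign σ : ℤ) : MvPolynomial (Fin L) ℂ) * vander L := by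
  rw [vander_eq_det, ← Matrix.det_permute, AlgHom.map_det]
  congr 1
  ext1 i j
  simp [Matrix.projVandermonde_apply, Matrix.map_apply]

/-- Coefficients of antisymmetric polynomials at exponents with a repetition vanish. -/
theorem coeff_vander_mul_eq_zero {L : ℕ} {P : MvPolynomial (Fin L) ℂ} (hP : P.IsSymmetric)
    {a : Fin L →₀ ℕ} {i j : Fin L} (hij : i ≠ j) (h : a i = a j) :
    coeff a (vander L * P) = 0 := by
  have h1 : rename (Equiv.swap i j) (vander L * P) = -(vander L * P) := by
    rw [map_mul, rename_vander, hP, Equiv.Perm.sign_swap hij]; simp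
  have h2 : a.mapDomain (Equiv.swap i j) = a := by
    ext k
    have : k = Equiv.swap i j (Equiv.swap i j k) := by simp
    conv_lhs => rw [this]
    rw [Finsupp.mapDomain_apply (Equiv.swap i j).injective]
    by_cases hi : k = i
    · subst hi; simp [h]
    · by_cases hj : k = j
      · subst hj; simp [h]
      · rw [Equiv.swap_apply_of_ne_of_ne hi hj]
  have h3 := coeff_rename_mapDomain (Equiv.swap i j) (Equiv.swap i j).injective (vander L * P) a
  rw [h2, h1, coeff_neg] at h3
  linear_combination (-1 / 2 : ℂ) * h3

/-- The exponents of every monomial are a permutation of 0, …, L-1, so all monomials share one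
eigenvalue. -/
theorem sum_euler_euler_vander (L : ℕ) :
    ∑ i : Fin L, euler i (euler i (vander L)) = (∑ i : Fin L, ((i : ℕ) : ℂ) ^ 2) • vander L := by
  simp only [vander_eq_sum, map_sum, Finset.smul_sum]
  rw [Finset.sum_comm]
  refine Finset.sum_congr rfl fun σ _ => ?_
  simp only [euler_monomial, Derivation.map_smul, smul_smul, ← Finset.sum_smul]
  congr 1
  rw [← Equiv.sum_comp ((σ⁻¹ : Equiv.Perm (Fin L)).trans Fin.revPerm)
    fun i : Fin L => ((i : ℕ) : ℂ) ^ 2]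
  refine Finset.sum_congr rfl fun i _ => ?_
  rw [vanderExp_apply, sq]; rfl

theorem euler_vander {L : ℕ} (i : Fin L) :
    euler i (vander L) = ∑ p ∈ pairs L, vanderErase p * euler i (X p.1 - X p.2) := by
  rw [vander, derivation_prod]; rfl

theorem sum_euler_X_mul {L : ℕ} (i : Fin L) (G : Fin L → MvPolynomial (Fin L) ℂ) :
    ∑ k, euler k (X i : MvPolynomial (Fin L) ℂ) * G k = X i * G i := by
  simp [euler_X]

/-- By the Leibniz rule, only two of the Euler operators see a given factor. -/
theorem sum_euler_vander_mul {L : ℕ} (G : Fin L → MvPolynomial (Fin L) ℂ) :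
    ∑ k, euler k (vander L) * G k =
      ∑ p ∈ pairs L, vanderErase p * (X p.1 * G p.1 - X p.2 * G p.2) := by
  simp only [euler_vander, Finset.sum_mul]
  rw [Finset.sum_comm]
  refine Finset.sum_congr rfl fun p _ => ?_
  rw [← sum_euler_X_mul, ← sum_euler_X_mul, ← Finset.sum_sub_distrib, Finset.mul_sum]
  refine Finset.sum_congr rfl fun k _ => ?_
  rw [map_sub]; ring

theorem sum_pairs {M : Type*} [AddCommGroup M] [Module ℂ M] {L : ℕ} (G : Fin L → M) :
    ∑ p ∈ pairs L, (G p.1 + G p.2) = ((L : ℂ) - 1) • ∑ k, G k := by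
  have h1 : ∑ p ∈ pairs L, (G p.1 + G p.2) =
      ∑ p ∈ (Finset.univ : Finset (Fin L × Fin L)).filter (fun p => p.1 ≠ p.2), G p.1 := by
    have hd : (Finset.univ : Finset (Fin L × Fin L)).filter (fun p => p.1 ≠ p.2) =
        pairs L ∪ (Finset.univ.filter fun p => p.2 < p.1) := by
      ext p; simp [pairs, lt_or_lt_iff_ne]
    rw [hd, Finset.sum_union, Finset.sum_add_distrib]
    · congr 1
      refine Finset.sum_nbij' Prod.swap Prod.swap ?_ ?_ ?_ ?_ ?_ <;> simp [pairs]
    · rw [Finset.disjoint_left]; intro p; simp only [pairs, Finset.mem_filter]; intro h1 h2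
      exact absurd h1.2 (not_lt.2 h2.2.le)
  rw [h1, Finset.sum_filter, ← Finset.univ_product_univ, Finset.sum_product, Finset.smul_sum]
  refine Finset.sum_congr rfl fun i _ => ?_
  dsimp only
  rw [← Finset.sum_filter, Finset.sum_const, Finset.filter_ne, Finset.card_erase_of_mem
    (Finset.mem_univ _), Finset.card_univ, Fintype.card_fin, ← Nat.cast_smul_eq_nsmul ℂ,
    Nat.cast_sub (Nat.one_le_of_lt i.pos)]
  simp

/-- A pair contributes X_i² - X_j² = (X_i - X_j)(X_i + X_j), which restores the erased factor; each
index lies in L-1 pairs. -/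
theorem sum_X_mul_euler_vander (L : ℕ) :
    ∑ k, X k * euler k (vander L) = ((L : ℂ) - 1) • (psum (Fin L) ℂ 1 * vander L) := by
  have h := sum_euler_vander_mul (L := L) X
  simp only [mul_comm] at h
  simp only [mul_comm (X _) (euler _ _)]
  simp only [mul_comm (euler _ _) (X _)]
  rw [h, psum, Finset.sum_mul, ← sum_pairs]
  refine Finset.sum_congr rfl fun p hp => ?_
  rw [← vanderErase_mul hp]
  ring

/-- A second order differential identity: if the `Q p` are the divided differences of the first
derivatives of `P`, the Vandermonde product conjugates the operator on the left into one with
constant coefficients in the Euler operators. -/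
theorem vander_mul_cutJoin {L : ℕ} (n : ℕ) (P : MvPolynomial (Fin L) ℂ)
    (Q : Fin L × Fin L → MvPolynomial (Fin L) ℂ)
    (hQ : ∀ p ∈ pairs L, (X p.1 - X p.2) * Q p = X p.2 * euler p.1 P - X p.1 * euler p.2 P)
    (hP : ∑ k, euler k P = (n : ℂ) • P) :
    vander L * (∑ k, euler k (euler k P) + 2 * ∑ p ∈ pairs L, Q p) =
      ∑ k, euler k (euler k (vander L * P)) -
        ((∑ i : Fin L, ((i : ℕ) : ℂ) ^ 2) + 2 * ((L : ℂ) - 1) * n) • (vander L * P) := by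
  have h1 : ∑ k, euler k (euler k (vander L * P)) =
      (∑ k, euler k (euler k (vander L))) * P + 2 * ∑ k, euler k (vander L) * euler k P +
        vander L * ∑ k, euler k (euler k P) := by
    rw [Finset.sum_mul, Finset.mul_sum, Finset.mul_sum, ← Finset.sum_add_distrib,
      ← Finset.sum_add_distrib]
    refine Finset.sum_congr rfl fun k _ => ?_
    simp only [Derivation.leibniz, smul_eq_mul, map_add]
    ring
  have h2 : vander L * ∑ p ∈ pairs L, Q p = ∑ k, euler k (vander L) * euler k P -
      vander L * (((L : ℂ) - 1) • ∑ k, euler k P) := by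
    rw [sum_euler_vander_mul, ← sum_pairs, Finset.mul_sum, Finset.mul_sum,
      ← Finset.sum_sub_distrib]
    refine Finset.sum_congr rfl fun p hp => ?_
    -- Writing E for Euler operators: X_i E_i P - X_j E_j P = (X_j E_i P - X_i E_j P) + (X_i -
    -- X_j)(E_i P + E_j P).
    rw [← vanderErase_mul hp, mul_assoc, hQ p hp]
    ring
  rw [h1, sum_euler_euler_vander, mul_add, mul_left_comm, h2, hP]
  simp only [smul_eq_C_mul, map_add, map_mul, map_sub, map_ofNat, map_natCast, map_one]
  ring

/-! ### Colorings invariant under a permutation -/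

/-- The monomial of a coloring. -/
noncomputable def wt {n L : ℕ} (f : Fin n → Fin L) : MvPolynomial (Fin L) ℂ :=
  ∏ k, X (f k)

/-- The sum of the monomials of the colorings that are invariant under `g`. -/
noncomputable def fixPoly {n : ℕ} (L : ℕ) (g : Equiv.Perm (Fin n)) : MvPolynomial (Fin L) ℂ :=
  ∑ f : Fin n → Fin L with ∀ m, f (g m) = f m, wt f

theorem wt_update {n L : ℕ} (h : Fin n → Fin L) (l : Fin n) (j : Fin L) :
    X (h l) * wt (Function.update h l j) = X j * wt h := by
  rw [wt, wt, ← Finset.mul_prod_erase _ _ (Finset.mem_univ l),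
    ← Finset.mul_prod_erase _ (fun k => (X (h k) : MvPolynomial (Fin L) ℂ)) (Finset.mem_univ l),
    Finset.prod_congr rfl (g := fun k => X (h k)) fun k hk => by
      rw [Function.update_of_ne (Finset.ne_of_mem_erase hk)], Function.update_self]
  ring

theorem wt_comp_perm {n L : ℕ} (f : Fin n → Fin L) (g : Equiv.Perm (Fin n)) :
    wt (f ∘ g) = wt f :=
  Equiv.prod_comp g fun k => (X (f k) : MvPolynomial (Fin L) ℂ)

theorem euler_wt {n L : ℕ} (i : Fin L) (f : Fin n → Fin L) :
    euler i (wt f) = ∑ k, if f k = i then wt f else 0 := by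
  rw [wt, derivation_prod]
  refine Finset.sum_congr rfl fun k _ => ?_
  rw [euler_X]
  split_ifs with h
  · exact Finset.prod_erase_mul _ _ (Finset.mem_univ k)
  · rw [mul_zero]

theorem euler_fixPoly {n L : ℕ} (i : Fin L) (g : Equiv.Perm (Fin n)) :
    euler i (fixPoly L g) =
      ∑ k, ∑ f : Fin n → Fin L with f k = i ∧ ∀ m, f (g m) = f m, wt f := by
  rw [fixPoly, map_sum, Finset.sum_congr rfl fun f _ => euler_wt i f, Finset.sum_comm]
  refine Finset.sum_congr rfl fun k _ => ?_
  rw [← Finset.sum_filter, Finset.filter_filter]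
  refine Finset.sum_congr (by ext; simp [and_comm]) fun _ _ => rfl

theorem sum_euler_fixPoly {n L : ℕ} (g : Equiv.Perm (Fin n)) :
    ∑ i, euler i (fixPoly L g) = (n : ℂ) • fixPoly L g := by
  simp only [fixPoly, map_sum, euler_wt]
  rw [Finset.sum_comm, Finset.smul_sum]
  refine Finset.sum_congr rfl fun f _ => ?_
  rw [Finset.sum_comm]
  simp [Nat.cast_smul_eq_nsmul]

/-- An Euler operator counts the points of its color; applied twice, it counts ordered pairs of such
points. -/
theorem sum_euler_euler_fixPoly {n L : ℕ} (g : Equiv.Perm (Fin n)) :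
    ∑ i, euler i (euler i (fixPoly L g)) =
      ∑ k, ∑ l, ∑ f : Fin n → Fin L with f k = f l ∧ ∀ m, f (g m) = f m, wt f := by
  have key : ∀ k, ∑ i, ∑ f : Fin n → Fin L with f k = i ∧ ∀ m, f (g m) = f m, euler i (wt f) =
      ∑ f : Fin n → Fin L with ∀ m, f (g m) = f m, euler (f k) (wt f) := by
    intro k
    simp only [Finset.sum_filter]
    rw [Finset.sum_comm]
    refine Finset.sum_congr rfl fun f _ => ?_
    simp only [ite_and, Finset.sum_ite_eq, Finset.mem_univ, if_true]
  simp only [euler_fixPoly, map_sum]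
  rw [Finset.sum_comm]
  refine Finset.sum_congr rfl fun k _ => ?_
  rw [key]
  simp only [euler_wt]
  rw [Finset.sum_comm]
  refine Finset.sum_congr rfl fun l _ => ?_
  rw [← Finset.sum_filter, Finset.filter_filter]
  refine Finset.sum_congr (Finset.filter_congr fun f _ => ?_) fun _ _ => rfl
  rw [and_comm, eq_comm]

theorem fixPoly_conj {n L : ℕ} (g h : Equiv.Perm (Fin n)) :
    fixPoly L (h * g * h⁻¹) = fixPoly L g := by
  refine Finset.sum_nbij' (fun f => f ∘ h) (fun f => f ∘ h.symm) ?_ ?_ ?_ ?_ ?_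
  · intro f hf
    simp only [Finset.mem_filter, Finset.mem_univ, true_and] at hf ⊢
    intro m; simpa using hf (h m)
  · intro f hf
    simp only [Finset.mem_filter, Finset.mem_univ, true_and] at hf ⊢
    intro m; simpa using hf (h.symm m)
  · intro f _; ext; simp
  · intro f _; ext; simp
  · intro f _; exact (wt_comp_perm f h).symm

/-- The contribution of the transpositions of a point of color `i` with a point of color `j`. -/
noncomputable def crossPoly {n L : ℕ} (g : Equiv.Perm (Fin n)) (i j : Fin L) :
    MvPolynomial (Fin L) ℂ :=
  ∑ k, ∑ l, ∑ f : Fin n → Fin L with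
    f k = i ∧ f l = j ∧ ∀ m, f (Equiv.swap k l (g m)) = f m, wt f

theorem crossPoly_comm {n L : ℕ} (g : Equiv.Perm (Fin n)) (i j : Fin L) :
    crossPoly g i j = crossPoly g j i := by
  rw [crossPoly, Finset.sum_comm]
  refine Finset.sum_congr rfl fun k _ => Finset.sum_congr rfl fun l _ => ?_
  refine Finset.sum_congr ?_ fun _ _ => rfl
  ext f
  simp only [Finset.mem_filter, Finset.mem_univ, true_and, Equiv.swap_comm l k]
  tauto

/-- An auxiliary sum that can be evaluated in two ways. -/
noncomputable def twistPoly {n L : ℕ} (g : Equiv.Perm (Fin n)) (i j : Fin L) :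
    MvPolynomial (Fin L) ℂ :=
  ∑ k, ∑ l, ∑ h : Fin n → Fin L with
    h k = i ∧ h l = i ∧ ∀ m, Function.update h k j (g m) = Function.update h l j m, wt h

/-- Reindex by l = g u. If k = g u, the twisted condition is invariance under g; otherwise it forces
h (g u) = j and becomes invariance under the transposition of k and g u times g. -/
theorem twistPoly_eq {n L : ℕ} (g : Equiv.Perm (Fin n)) {i j : Fin L} (hij : i ≠ j) :
    twistPoly g i j = crossPoly g i j + euler i (fixPoly L g) := by
  rw [twistPoly, crossPoly, euler_fixPoly, ← Finset.sum_add_distrib]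
  refine Finset.sum_congr rfl fun k _ => ?_
  have hk : ∑ f : Fin n → Fin L with f k = i ∧ ∀ m, f (g m) = f m, wt f =
      ∑ l, if k = l then ∑ f : Fin n → Fin L with f k = i ∧ ∀ m, f (g m) = f m, wt f else 0 := by
    simp
  rw [← Equiv.sum_comp g⁻¹, hk, ← Finset.sum_add_distrib]
  refine Finset.sum_congr rfl fun l _ => ?_
  obtain ⟨u, rfl⟩ := g.surjective l
  rw [show g⁻¹ (g u) = u from g.symm_apply_apply u]
  by_cases hkl : k = g u
  · subst hkl
    rw [if_pos rfl]
    rw [Finset.sum_eq_zero (s := Finset.univ.filter fun f : Fin n → Fin L =>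
      f (g u) = i ∧ f (g u) = j ∧ _), zero_add]
    · refine Finset.sum_congr (Finset.filter_congr fun h _ => ?_) fun _ _ => rfl
      constructor
      · rintro ⟨h1, h2, h3⟩
        refine ⟨h1, fun m => ?_⟩
        by_cases hm : m = u
        · subst hm; rw [h1, h2]
        · simpa [Function.update_apply, hm] using h3 m
      · rintro ⟨h1, h2⟩
        refine ⟨h1, (h2 u).symm.trans h1, fun m => ?_⟩
        by_cases hm : m = u
        · subst hm; simp
        · simpa [Function.update_apply, hm] using h2 m
    · intro f hf
      simp only [Finset.mem_filter] at hf
      exact absurd (hf.2.1.symm.trans hf.2.2.1) hij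
  · rw [if_neg hkl, add_zero]
    refine Finset.sum_congr (Finset.filter_congr fun h _ => ?_) fun _ _ => rfl
    constructor
    · rintro ⟨h1, h2, h3⟩
      have h4 : h (g u) = j := by
        have := h3 u
        rwa [Function.update_of_ne (Ne.symm hkl), Function.update_self] at this
      refine ⟨h1, h4, fun m => ?_⟩
      by_cases hm : m = u
      · subst hm; rw [Equiv.swap_apply_right, h1, h2]
      · have h5 := h3 m
        rw [Function.update_of_ne hm] at h5
        by_cases hk : g m = k
        · rw [hk, Equiv.swap_apply_left, h4, ← h5, hk, Function.update_self]
        · rw [Equiv.swap_apply_of_ne_of_ne hk (fun h => hm (g.injective h)), ← h5,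
            Function.update_of_ne hk]
    · rintro ⟨h1, h2, h3⟩
      have h4 : h u = i := by
        have := h3 u
        rwa [Equiv.swap_apply_right, h1, eq_comm] at this
      refine ⟨h1, h4, fun m => ?_⟩
      by_cases hm : m = u
      · subst hm; rw [Function.update_of_ne (Ne.symm hkl), Function.update_self, h2]
      · have h5 := h3 m
        rw [Function.update_of_ne hm]
        by_cases hk : g m = k
        · rw [hk, Equiv.swap_apply_left, h2] at h5
          rw [hk, Function.update_self, h5]
        · rw [Equiv.swap_apply_of_ne_of_ne hk (fun h => hm (g.injective h))] at h5
          rw [Function.update_of_ne hk, h5]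

/-- Recoloring l from i to j trades a factor X i for X j. For k ≠ l, then changing k to j and l to i
exchanges their two colors, which gives `crossPoly`; the case k = l gives the Euler term. -/
theorem X_mul_twistPoly {n L : ℕ} (g : Equiv.Perm (Fin n)) {i j : Fin L} (hij : i ≠ j) :
    X j * twistPoly g i j = X i * (crossPoly g i j + euler j (fixPoly L g)) := by
  have key : ∀ k l, X j * ∑ h : Fin n → Fin L with
      h k = i ∧ h l = i ∧ ∀ m, Function.update h k j (g m) = Function.update h l j m, wt h =
      X i * (∑ f : Fin n → Fin L with
        f k = i ∧ f l = j ∧ ∀ m, f (Equiv.swap k l (g m)) = f m, wt f +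
        if l = k then ∑ f : Fin n → Fin L with f l = j ∧ ∀ m, f (g m) = f m, wt f else 0) := by
    intro k l
    have hw : ∑ h : Fin n → Fin L with
        h k = i ∧ h l = i ∧ ∀ m, Function.update h k j (g m) = Function.update h l j m,
          X j * wt h =
        ∑ f : Fin n → Fin L with f l = j ∧ Function.update f l i k = i ∧
          ∀ m, Function.update (Function.update f l i) k j (g m) = f m, X i * wt f := by
      refine Finset.sum_nbij' (fun h => Function.update h l j) (fun f => Function.update f l i)
        ?_ ?_ ?_ ?_ ?_
      · intro h hh
        simp only [Finset.mem_filter, Finset.mem_univ, true_and] at hh ⊢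
        obtain ⟨h1, h2, h3⟩ := hh
        have : Function.update (Function.update h l j) l i = h := by
          rw [Function.update_idem, ← h2, Function.update_eq_self]
        rw [this]
        exact ⟨Function.update_self .., h1, h3⟩
      · intro f hf
        simp only [Finset.mem_filter, Finset.mem_univ, true_and] at hf ⊢
        obtain ⟨h1, h2, h3⟩ := hf
        refine ⟨h2, Function.update_self .., fun m => ?_⟩
        rw [h3 m, Function.update_idem, ← h1, Function.update_eq_self]
      · intro h hh
        simp only [Finset.mem_filter, Finset.mem_univ, true_and] at hh
        rw [Function.update_idem, ← hh.2.1, Function.update_eq_self]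
      · intro f hf
        simp only [Finset.mem_filter, Finset.mem_univ, true_and] at hf
        rw [Function.update_idem, ← hf.1, Function.update_eq_self]
      · intro h hh
        simp only [Finset.mem_filter, Finset.mem_univ, true_and] at hh
        rw [← wt_update, hh.2.1]
    rw [Finset.mul_sum, hw, ← Finset.mul_sum]
    congr 1
    by_cases hkl : l = k
    · subst hkl
      rw [if_pos rfl]
      rw [Finset.sum_eq_zero (s := Finset.univ.filter fun f : Fin n → Fin L =>
        f l = i ∧ f l = j ∧ _), zero_add]
      · refine Finset.sum_congr (Finset.filter_congr fun f _ => ?_) fun _ _ => rfl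
        constructor
        · rintro ⟨rfl, -, h3⟩
          exact ⟨rfl, by simpa using h3⟩
        · rintro ⟨rfl, h3⟩
          exact ⟨rfl, by simp, by simpa using h3⟩
      · intro f hf
        simp only [Finset.mem_filter] at hf
        exact absurd (hf.2.1.symm.trans hf.2.2.1) hij
    · rw [if_neg hkl, add_zero]
      refine Finset.sum_congr (Finset.filter_congr fun f _ => ?_) fun _ _ => rfl
      rw [Function.update_of_ne (Ne.symm hkl)]
      have hs : f l = j → f k = i → ∀ m,
          Function.update (Function.update f l i) k j m = f (Equiv.swap k l m) := by
        intro h1 h2 m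
        by_cases hk : m = k
        · subst hk; simp [h1]
        · rw [Function.update_of_ne hk]
          by_cases hl : m = l
          · subst hl; simp [h2]
          · rw [Function.update_of_ne hl, Equiv.swap_apply_of_ne_of_ne hk hl]
      constructor
      · rintro ⟨h1, h2, h3⟩
        exact ⟨h2, h1, fun m => by rw [← hs h1 h2, h3]⟩
      · rintro ⟨h2, h1, h3⟩
        exact ⟨h1, h2, fun m => by rw [hs h1 h2, h3]⟩
  rw [twistPoly, Finset.mul_sum, crossPoly, euler_fixPoly, Finset.sum_comm (s := Finset.univ),
    Finset.sum_comm (s := Finset.univ) (t := Finset.univ), ← Finset.sum_add_distrib,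
    Finset.mul_sum]
  refine Finset.sum_congr rfl fun k _ => ?_
  rw [Finset.mul_sum, Finset.sum_congr rfl fun l _ => key k l, ← Finset.mul_sum,
    Finset.sum_add_distrib, Finset.sum_ite_eq' Finset.univ k, if_pos (Finset.mem_univ k)]

theorem sub_mul_crossPoly {n L : ℕ} (g : Equiv.Perm (Fin n)) {i j : Fin L} (hij : i ≠ j) :
    (X i - X j) * crossPoly g i j =
      X j * euler i (fixPoly L g) - X i * euler j (fixPoly L g) := by
  have h := X_mul_twistPoly g hij
  rw [twistPoly_eq g hij] at h
  linear_combination -h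

/-- Split the invariant colorings by whether k and l share a color. If they do, the transposition is
invisible; if not, the pair of colors selects a `crossPoly`, and both orders of the pair give the
factor 2. -/
theorem sum_fixPoly_swap_mul {n L : ℕ} (g : Equiv.Perm (Fin n)) :
    ∑ k, ∑ l, fixPoly L (Equiv.swap k l * g) =
      ∑ i, euler i (euler i (fixPoly L g)) + 2 * ∑ p ∈ pairs L, crossPoly g p.1 p.2 := by
  have hc : 2 * ∑ p ∈ pairs L, crossPoly g p.1 p.2 =
      ∑ k, ∑ l, ∑ f : Fin n → Fin L with
        f k ≠ f l ∧ ∀ m, f (Equiv.swap k l (g m)) = f m, wt f := by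
    have h1 : 2 * ∑ p ∈ pairs L, crossPoly g p.1 p.2 =
        ∑ p ∈ (Finset.univ : Finset (Fin L × Fin L)).filter (fun p => p.1 ≠ p.2),
          crossPoly g p.1 p.2 := by
      have hd : (Finset.univ : Finset (Fin L × Fin L)).filter (fun p => p.1 ≠ p.2) =
          pairs L ∪ (Finset.univ.filter fun p => p.2 < p.1) := by
        ext p; simp [pairs, lt_or_lt_iff_ne]
      rw [hd, Finset.sum_union, two_mul]
      · congr 1
        refine Finset.sum_nbij' Prod.swap Prod.swap ?_ ?_ ?_ ?_ ?_ <;>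
          simp [pairs, crossPoly_comm g]
      · rw [Finset.disjoint_left]; intro p; simp only [pairs, Finset.mem_filter]; intro h1 h2
        exact absurd h1.2 (not_lt.2 h2.2.le)
    rw [h1]
    simp only [crossPoly]
    rw [Finset.sum_comm]
    refine Finset.sum_congr rfl fun k _ => ?_
    rw [Finset.sum_comm]
    refine Finset.sum_congr rfl fun l _ => ?_
    rw [← Finset.sum_fiberwise_of_maps_to (s := Finset.univ.filter fun f : Fin n → Fin L =>
      f k ≠ f l ∧ ∀ m, f (Equiv.swap k l (g m)) = f m) (g := fun f => (f k, f l))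
      (t := Finset.univ.filter fun p : Fin L × Fin L => p.1 ≠ p.2)]
    · refine Finset.sum_congr rfl fun p hp => ?_
      refine Finset.sum_congr ?_ fun _ _ => rfl
      ext f
      simp only [Finset.mem_filter, Finset.mem_univ, true_and, Prod.ext_iff] at hp ⊢
      constructor
      · rintro ⟨h1, h2, h3⟩
        exact ⟨⟨by rwa [h1, h2], h3⟩, h1, h2⟩
      · rintro ⟨⟨h1, h2⟩, h3, h4⟩
        exact ⟨h3, h4, h2⟩
    · intro f hf
      simp only [Finset.mem_filter, Finset.mem_univ, true_and] at hf ⊢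
      exact hf.1
  rw [hc, sum_euler_euler_fixPoly, ← Finset.sum_add_distrib]
  refine Finset.sum_congr rfl fun k _ => ?_
  rw [← Finset.sum_add_distrib]
  refine Finset.sum_congr rfl fun l _ => ?_
  rw [fixPoly, ← Finset.sum_filter_add_sum_filter_not _ (fun f => f k = f l), Finset.filter_filter,
    Finset.filter_filter]
  congr 1
  · refine Finset.sum_congr (Finset.filter_congr fun f _ => ?_) fun _ _ => rfl
    rw [and_comm]
    refine and_congr_right fun h => forall_congr' fun m => ?_
    have : f ((Equiv.swap k l * g) m) = f (g m) := by
      rw [Equiv.Perm.mul_apply, Equiv.swap_apply_def]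
      split_ifs with h1 h2
      · rw [h1, h]
      · rw [h2, h]
      · rfl
    rw [this]
  · refine Finset.sum_congr (Finset.filter_congr fun f _ => ?_) fun _ _ => rfl
    rw [and_comm]; rfl

/-- After conjugation by the Vandermonde product the operator is diagonal on monomials, so every
coefficient is an eigenfunction of the sum over transpositions. -/
theorem sum_coeff_vander_fixPoly_swap {n L : ℕ} (g : Equiv.Perm (Fin n)) (a : Fin L →₀ ℕ) :
    ∑ k, ∑ l, coeff a (vander L * fixPoly L (Equiv.swap k l * g)) =
      (∑ i, (a i : ℂ) ^ 2 - ((∑ i : Fin L, ((i : ℕ) : ℂ) ^ 2) + 2 * ((L : ℂ) - 1) * n)) *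
        coeff a (vander L * fixPoly L g) := by
  simp only [← coeff_sum, ← Finset.mul_sum]
  rw [sum_fixPoly_swap_mul, vander_mul_cutJoin n (fixPoly L g) (fun p => crossPoly g p.1 p.2)
    (fun p hp => sub_mul_crossPoly g (Finset.mem_filter.1 hp).2.ne) (sum_euler_fixPoly g),
    coeff_sub, coeff_smul, coeff_sum, smul_eq_mul, sub_mul, Finset.sum_mul]
  congr 1
  refine Finset.sum_congr rfl fun i _ => ?_
  rw [coeff_euler, coeff_euler]; ring

/-! ### Tableaux and column injective functions -/

theorem IsPartition.antitone {μ : ℕ →₀ ℕ} {n : ℕ} (hμ : IsPartition μ n) : Antitone μ :=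
  antitone_nat_of_succ_le hμ.1

theorem partialSum_succ (γ : ℕ →₀ ℕ) (j : ℕ) : partialSum γ (j + 1) = partialSum γ j + γ j :=
  Finset.sum_range_succ _ _

theorem partialSum_mono (γ : ℕ →₀ ℕ) : Monotone (partialSum γ) :=
  monotone_nat_of_le_succ fun j => by rw [partialSum_succ]; exact Nat.le_add_right _ _

theorem partialSum_le_degree (γ : ℕ →₀ ℕ) (j : ℕ) : partialSum γ j ≤ γ.degree := by
  classical
  rw [Finsupp.degree_apply, partialSum, ← Finset.sum_filter_ne_zero]
  refine Finset.sum_le_sum_of_subset fun i hi => ?_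
  simpa using (Finset.mem_filter.1 hi).2

theorem partialSum_eq_degree {γ : ℕ →₀ ℕ} {j : ℕ} (h : ∀ k, j ≤ k → γ k = 0) :
    partialSum γ j = γ.degree := by
  rw [Finsupp.degree_apply, partialSum]
  refine (Finset.sum_subset (fun i hi => ?_) fun i _ hi => by simpa using hi).symm
  by_contra hij
  exact (Finsupp.mem_support_iff.1 hi) (h i (by simpa using hij))

theorem exists_forall_ge_eq_zero (γ : ℕ →₀ ℕ) : ∃ l, ∀ k, l ≤ k → γ k = 0 := by
  refine ⟨γ.support.sup id + 1, fun k hk => ?_⟩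
  by_contra h
  have := Finset.le_sup (f := id) (Finsupp.mem_support_iff.2 h)
  simp only [id] at this; omega

theorem len_spec (γ : ℕ →₀ ℕ) {k : ℕ} (hk : len γ ≤ k) : γ k = 0 :=
  Nat.sInf_mem (s := {l | ∀ k, l ≤ k → γ k = 0}) (exists_forall_ge_eq_zero γ) k hk

theorem len_le {γ : ℕ →₀ ℕ} {l : ℕ} (h : ∀ k, l ≤ k → γ k = 0) : len γ ≤ l :=
  Nat.sInf_le h

theorem partialSum_eq_of_len_le {γ : ℕ →₀ ℕ} {j : ℕ} (h : len γ ≤ j) :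
    partialSum γ j = γ.degree :=
  partialSum_eq_degree fun _ hk => len_spec γ (h.trans hk)

theorem rowOf_lt_iff {μ : ℕ →₀ ℕ} {n k j : ℕ} (hμ : IsPartition μ n) (hk : k < n) :
    rowOf μ k < j ↔ k < partialSum μ j := by
  have hne : {i | k < partialSum μ (i + 1)}.Nonempty :=
    ⟨len μ, by rw [Set.mem_ofPred_eq, partialSum_eq_of_len_le (Nat.le_succ _), hμ.2]; exact hk⟩
  constructor
  · intro h
    have hmem : k < partialSum μ (rowOf μ k + 1) := Nat.sInf_mem hne
    exact hmem.trans_le (partialSum_mono μ (Nat.succ_le_of_lt h))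
  · intro h
    cases j with
    | zero => simp [partialSum] at h
    | succ j => exact Nat.lt_succ_of_le (Nat.sInf_le h)

theorem partialSum_rowOf_le {μ : ℕ →₀ ℕ} {n k : ℕ} (hμ : IsPartition μ n) (hk : k < n) :
    partialSum μ (rowOf μ k) ≤ k := by
  by_contra h
  exact lt_irrefl _ ((rowOf_lt_iff hμ hk).2 (not_le.1 h))

theorem partialSum_rowOf_add_colOf {μ : ℕ →₀ ℕ} {n k : ℕ} (hμ : IsPartition μ n) (hk : k < n) :
    partialSum μ (rowOf μ k) + colOf μ k = k :=
  Nat.add_sub_cancel' (partialSum_rowOf_le hμ hk)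

theorem colOf_lt {μ : ℕ →₀ ℕ} {n k : ℕ} (hμ : IsPartition μ n) (hk : k < n) :
    colOf μ k < μ (rowOf μ k) := by
  have h1 := partialSum_rowOf_add_colOf hμ hk
  have h2 := (rowOf_lt_iff hμ hk).1 (Nat.lt_succ_self _)
  rw [Nat.succ_eq_add_one, partialSum_succ] at h2
  omega

theorem colOf_lt_self {μ : ℕ →₀ ℕ} {n k : ℕ} (hk : k < n) : colOf μ k < n :=
  (Nat.sub_le _ _).trans_lt hk

theorem exists_cell {μ : ℕ →₀ ℕ} {n r c : ℕ} (hμ : IsPartition μ n) (hc : c < μ r) :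
    ∃ k : Fin n, rowOf μ k = r ∧ colOf μ k = c := by
  have h1 := partialSum_succ μ r
  have h2 := partialSum_le_degree μ (r + 1)
  rw [hμ.2] at h2
  have hk : partialSum μ r + c < n := by omega
  have h3 : rowOf μ (partialSum μ r + c) = r := by
    apply le_antisymm
    · exact Nat.lt_succ_iff.1 ((rowOf_lt_iff hμ hk).2 (by rw [Nat.succ_eq_add_one]; omega))
    · by_contra h
      have := (rowOf_lt_iff hμ hk).1 (not_le.1 h)
      omega
  refine ⟨⟨_, hk⟩, h3, ?_⟩
  rw [colOf, h3]; simp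

theorem cell_injective {μ : ℕ →₀ ℕ} {n : ℕ} (hμ : IsPartition μ n) {k l : Fin n}
    (hr : rowOf μ k = rowOf μ l) (hc : colOf μ k = colOf μ l) : k = l := by
  apply Fin.ext
  rw [← partialSum_rowOf_add_colOf hμ k.2, ← partialSum_rowOf_add_colOf hμ l.2, hr, hc]

theorem card_rowOf_lt {μ : ℕ →₀ ℕ} {n : ℕ} (hμ : IsPartition μ n) (j : ℕ) :
    (Finset.univ.filter fun k : Fin n => rowOf μ k < j).card = partialSum μ j := by
  have h := partialSum_le_degree μ j
  rw [hμ.2] at h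
  rw [Finset.filter_congr fun (k : Fin n) _ => rowOf_lt_iff hμ k.2, Fin.card_filter_val_lt]
  exact min_eq_right h

/-- `f` takes different values on the elements of each column of the tableau of shape `μ`. -/
def ColumnInjective (μ : ℕ →₀ ℕ) {n : ℕ} (f : Fin n → ℕ) : Prop :=
  ∀ k l : Fin n, colOf μ k = colOf μ l → f k = f l → k = l

/-- The dominance order. -/
def Dominated (γ μ : ℕ →₀ ℕ) : Prop :=
  ∀ j, partialSum γ j ≤ partialSum μ j

theorem Dominated.antisymm {γ μ : ℕ →₀ ℕ} (h : Dominated γ μ) (h' : Dominated μ γ) : γ = μ := by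
  ext j
  have h1 := partialSum_succ γ j
  have h2 := partialSum_succ μ j
  have := h j; have := h' j; have := h (j + 1); have := h' (j + 1)
  omega

/-- At most j points of a column take values below j. If the column reaches row j, its first j rows
supply j points; if not, the right side counts the whole column. -/
theorem ColumnInjective.card_column_le {μ : ℕ →₀ ℕ} {n : ℕ} (hμ : IsPartition μ n)
    {f : Fin n → ℕ} (hf : ColumnInjective μ f) (j c : ℕ) :
    (Finset.univ.filter fun k : Fin n => f k < j ∧ colOf μ k = c).card ≤
      (Finset.univ.filter fun k : Fin n => rowOf μ k < j ∧ colOf μ k = c).card := by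
  by_cases h : ∃ k : Fin n, colOf μ k = c ∧ j ≤ rowOf μ k
  · obtain ⟨k, hk, hj⟩ := h
    trans j
    · rw [← Finset.card_range j]
      refine Finset.card_le_card_of_injOn f (fun l hl => ?_) fun l hl l' hl' h => ?_
      · simp only [Finset.coe_filter, Set.mem_ofPred_eq] at hl
        simpa using hl.2.1
      · simp only [Finset.coe_filter, Set.mem_ofPred_eq] at hl hl'
        exact hf l l' (hl.2.2.trans hl'.2.2.symm) h
    · have hex : ∀ r ∈ Finset.range j, ∃ l : Fin n, rowOf μ l = r ∧ colOf μ l = c := by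
        intro r hr
        refine exists_cell hμ ?_
        rw [← hk]
        exact (colOf_lt hμ k.2).trans_le (hμ.antitone ((Finset.mem_range.1 hr).le.trans hj))
      have : Nonempty (Fin n) := ⟨k⟩
      choose! F hF using hex
      conv_lhs => rw [← Finset.card_range j]
      refine Finset.card_le_card_of_injOn F (fun r hr => ?_) fun r hr r' hr' h => ?_
      · simp only [Finset.coe_filter, Set.mem_ofPred_eq, Finset.mem_univ, true_and]
        rw [(hF r hr).1]
        exact ⟨Finset.mem_range.1 hr, (hF r hr).2⟩
      · rw [← (hF r hr).1, ← (hF r' hr').1, h]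
  · push Not at h
    refine Finset.card_le_card fun k hk => ?_
    simp only [Finset.mem_filter, Finset.mem_univ, true_and] at hk ⊢
    exact ⟨h k hk.2, hk.2⟩

theorem card_eq_sum_card_columns {μ : ℕ →₀ ℕ} {n : ℕ} (f : Fin n → ℕ) (j : ℕ) :
    (Finset.univ.filter fun k : Fin n => f k < j).card =
      ∑ c ∈ Finset.range n,
        (Finset.univ.filter fun k : Fin n => f k < j ∧ colOf μ k = c).card := by
  rw [Finset.card_eq_sum_card_fiberwise (f := fun k : Fin n => colOf μ k) (t := Finset.range n)]
  · simp only [Finset.filter_filter]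
  · intro k _
    exact Finset.mem_coe.2 (Finset.mem_range.2 (colOf_lt_self k.2))

theorem ColumnInjective.card_lt_le {μ : ℕ →₀ ℕ} {n : ℕ} (hμ : IsPartition μ n)
    {f : Fin n → ℕ} (hf : ColumnInjective μ f) (j : ℕ) :
    (Finset.univ.filter fun k : Fin n => f k < j).card ≤ partialSum μ j := by
  rw [← card_rowOf_lt hμ, card_eq_sum_card_columns (μ := μ), card_eq_sum_card_columns (μ := μ)]
  exact Finset.sum_le_sum fun c _ => hf.card_column_le hμ j c

/-- Equality of the totals forces equality column by column. Comparing the counts for f k and f k +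
1 produces a cell in row f k of the column of k, and these cells define q. -/
theorem ColumnInjective.exists_colGroup {μ : ℕ →₀ ℕ} {n : ℕ} (hμ : IsPartition μ n)
    {f : Fin n → ℕ} (hf : ColumnInjective μ f)
    (h : ∀ j, (Finset.univ.filter fun k : Fin n => f k < j).card = partialSum μ j) :
    ∃ q ∈ colGroup n μ, ∀ k, f k = rowOf μ (q k) := by
  have heq : ∀ j, ∀ c ∈ Finset.range n,
      (Finset.univ.filter fun k : Fin n => f k < j ∧ colOf μ k = c).card =
        (Finset.univ.filter fun k : Fin n => rowOf μ k < j ∧ colOf μ k = c).card := by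
    intro j
    refine (Finset.sum_eq_sum_iff_of_le fun c _ => hf.card_column_le hμ j c).1 ?_
    rw [← card_eq_sum_card_columns, ← card_eq_sum_card_columns, card_rowOf_lt hμ, h]
  have hex : ∀ k : Fin n, ∃ l : Fin n, rowOf μ l = f k ∧ colOf μ l = colOf μ k := by
    intro k
    have hc : colOf μ k ∈ Finset.range n := 
      Finset.mem_range.2 (colOf_lt_self k.2)
    have hlt : (Finset.univ.filter fun l : Fin n => f l < f k ∧ colOf μ l = colOf μ k).card <
        (Finset.univ.filter fun l : Fin n => f l < f k + 1 ∧ colOf μ l = colOf μ k).card := by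
      refine Finset.card_lt_card (Finset.ssubset_iff_of_subset (fun l hl => ?_) |>.2 ⟨k, ?_, ?_⟩)
      · simp only [Finset.mem_filter, Finset.mem_univ, true_and] at hl ⊢
        exact ⟨hl.1.trans (Nat.lt_succ_self _), hl.2⟩
      · simp
      · simp
    rw [heq _ _ hc, heq _ _ hc] at hlt
    obtain ⟨l, hl, hl'⟩ := Finset.exists_mem_notMem_of_card_lt_card hlt
    simp only [Finset.mem_filter, Finset.mem_univ, true_and, not_and] at hl hl'
    refine ⟨l, le_antisymm (Nat.lt_succ_iff.1 hl.1) (not_lt.1 fun h => hl' h hl.2), hl.2⟩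
  choose q hq hq' using hex
  have hinj : Function.Injective q := fun k l hkl => hf k l (by rw [← hq' k, ← hq' l, hkl])
    (by rw [← hq k, ← hq l, hkl])
  exact ⟨Equiv.ofBijective q (Finite.injective_iff_bijective.1 hinj), hq', fun k => (hq k).symm⟩

theorem swap_mem_colGroup {μ : ℕ →₀ ℕ} {n : ℕ} {k l : Fin n} (h : colOf μ k = colOf μ l) :
    Equiv.swap k l ∈ colGroup n μ := by
  intro m
  rw [Equiv.swap_apply_def]
  split_ifs with h1 h2
  · rw [h1, h]
  · rw [h2, h]
  · rfl

theorem swap_mem_rowGroup {μ : ℕ →₀ ℕ} {n : ℕ} {k l : Fin n} (h : rowOf μ k = rowOf μ l) :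
    Equiv.swap k l ∈ rowGroup n μ := by
  intro m
  rw [Equiv.swap_apply_def]
  split_ifs with h1 h2
  · rw [h1, h]
  · rw [h2, h]
  · rfl

theorem eq_one_of_mem_rowGroup_of_mem_colGroup {μ : ℕ →₀ ℕ} {n : ℕ} (hμ : IsPartition μ n)
    {τ : Equiv.Perm (Fin n)} (hr : τ ∈ rowGroup n μ) (hc : τ ∈ colGroup n μ) : τ = 1 :=
  Equiv.ext fun k => cell_injective hμ (hr k) (hc k)

theorem card_rowOf_perm_lt {γ : ℕ →₀ ℕ} {n : ℕ} (hγ : IsPartition γ n)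
    (g : Equiv.Perm (Fin n)) (j : ℕ) :
    (Finset.univ.filter fun k : Fin n => rowOf γ (g k) < j).card = partialSum γ j := by
  rw [← card_rowOf_lt hγ]
  refine Finset.card_bij' (fun k _ => g k) (fun k _ => g.symm k) ?_ ?_ ?_ ?_ <;> simp

/-- Otherwise the row numbers after g would be injective on columns, and counting values below j
would give dominance. -/
theorem exists_same_row_same_col {γ μ : ℕ →₀ ℕ} {n : ℕ} (hγ : IsPartition γ n)
    (hμ : IsPartition μ n) (h : ¬ Dominated γ μ) (g : Equiv.Perm (Fin n)) :
    ∃ k l : Fin n, k ≠ l ∧ colOf μ k = colOf μ l ∧ rowOf γ (g k) = rowOf γ (g l) := by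
  by_contra hne
  push Not at hne
  have hf : ColumnInjective μ fun k : Fin n => rowOf γ (g k) := fun k l h1 h2 => by
    by_contra h3; exact hne k l h3 h1 h2
  exact h fun j => (card_rowOf_perm_lt hγ g j).symm.trans_le (hf.card_lt_le hμ j)

/-! ### Row and column sums in the group algebra -/

open scoped Classical in
/-- The sum of the elements of the row group. -/
noncomputable def rowSum (n : ℕ) (μ : ℕ →₀ ℕ) : MonoidAlgebra ℂ (Equiv.Perm (Fin n)) :=
  ∑ τ with τ ∈ rowGroup n μ, MonoidAlgebra.single τ 1

open scoped Classical in
/-- The signed sum of the elements of the column group. -/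
noncomputable def colSum (n : ℕ) (μ : ℕ →₀ ℕ) : MonoidAlgebra ℂ (Equiv.Perm (Fin n)) :=
  ∑ τ with τ ∈ colGroup n μ, MonoidAlgebra.single τ ((Equiv.Perm.sign τ : ℤ) : ℂ)

theorem youngSymmetrizer_eq (n : ℕ) (μ : ℕ →₀ ℕ) :
    youngSymmetrizer n μ = rowSum n μ * colSum n μ := rfl

theorem rowSum_mul_single {n : ℕ} {μ : ℕ →₀ ℕ} {r : Equiv.Perm (Fin n)} (hr : r ∈ rowGroup n μ) :
    rowSum n μ * MonoidAlgebra.single r 1 = rowSum n μ := by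
  classical
  rw [rowSum, Finset.sum_mul]
  refine Finset.sum_nbij' (fun τ => τ * r) (fun τ => τ * r⁻¹) ?_ ?_ ?_ ?_ ?_
  · intro τ hτ
    simp only [Finset.mem_filter, Finset.mem_univ, true_and] at hτ ⊢
    exact mul_mem hτ hr
  · intro τ hτ
    simp only [Finset.mem_filter, Finset.mem_univ, true_and] at hτ ⊢
    exact mul_mem hτ (inv_mem hr)
  · intro τ _; simp
  · intro τ _; simp
  · intro τ _; rw [MonoidAlgebra.single_mul_single, mul_one]

theorem single_mul_rowSum {n : ℕ} {μ : ℕ →₀ ℕ} {r : Equiv.Perm (Fin n)} (hr : r ∈ rowGroup n μ) :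
    MonoidAlgebra.single r 1 * rowSum n μ = rowSum n μ := by
  classical
  rw [rowSum, Finset.mul_sum]
  refine Finset.sum_nbij' (fun τ => r * τ) (fun τ => r⁻¹ * τ) ?_ ?_ ?_ ?_ ?_
  · intro τ hτ
    simp only [Finset.mem_filter, Finset.mem_univ, true_and] at hτ ⊢
    exact mul_mem hr hτ
  · intro τ hτ
    simp only [Finset.mem_filter, Finset.mem_univ, true_and] at hτ ⊢
    exact mul_mem (inv_mem hr) hτ
  · intro τ _; simp
  · intro τ _; simp
  · intro τ _; rw [MonoidAlgebra.single_mul_single, mul_one]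

theorem colSum_mul_single {n : ℕ} {μ : ℕ →₀ ℕ} {q : Equiv.Perm (Fin n)} (hq : q ∈ colGroup n μ) :
    colSum n μ * MonoidAlgebra.single q 1 = ((Equiv.Perm.sign q : ℤ) : ℂ) • colSum n μ := by
  classical
  rw [colSum, Finset.sum_mul, Finset.smul_sum]
  refine Finset.sum_nbij' (fun τ => τ * q) (fun τ => τ * q⁻¹) ?_ ?_ ?_ ?_ ?_
  · intro τ hτ
    simp only [Finset.mem_filter, Finset.mem_univ, true_and] at hτ ⊢
    exact mul_mem hτ hq
  · intro τ hτ
    simp only [Finset.mem_filter, Finset.mem_univ, true_and] at hτ ⊢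
    exact mul_mem hτ (inv_mem hq)
  · intro τ _; simp
  · intro τ _; simp
  · intro τ _
    rw [MonoidAlgebra.single_mul_single, MonoidAlgebra.smul_single, mul_one, smul_eq_mul,
      Equiv.Perm.sign_mul]
    congr 1
    rcases Int.units_eq_one_or (Equiv.Perm.sign q) with h | h <;> rw [h] <;> simp

theorem single_mul_colSum {n : ℕ} {μ : ℕ →₀ ℕ} {q : Equiv.Perm (Fin n)} (hq : q ∈ colGroup n μ) :
    MonoidAlgebra.single q 1 * colSum n μ = ((Equiv.Perm.sign q : ℤ) : ℂ) • colSum n μ := by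
  classical
  rw [colSum, Finset.mul_sum, Finset.smul_sum]
  refine Finset.sum_nbij' (fun τ => q * τ) (fun τ => q⁻¹ * τ) ?_ ?_ ?_ ?_ ?_
  · intro τ hτ
    simp only [Finset.mem_filter, Finset.mem_univ, true_and] at hτ ⊢
    exact mul_mem hq hτ
  · intro τ hτ
    simp only [Finset.mem_filter, Finset.mem_univ, true_and] at hτ ⊢
    exact mul_mem (inv_mem hq) hτ
  · intro τ _; simp
  · intro τ _; simp
  · intro τ _
    rw [MonoidAlgebra.single_mul_single, MonoidAlgebra.smul_single, one_mul, smul_eq_mul,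
      Equiv.Perm.sign_mul]
    congr 1
    rcases Int.units_eq_one_or (Equiv.Perm.sign q) with h | h <;> rw [h] <;> simp

theorem eq_zero_of_eq_neg_self {M : Type*} [AddCommGroup M] [Module ℂ M] {x : M} (h : x = -x) :
    x = 0 := by
  have : (2 : ℂ) • x = 0 := by rw [two_smul]; nth_rewrite 2 [h]; exact add_neg_cancel x
  exact (smul_eq_zero.1 this).resolve_left two_ne_zero

/-- The transposition of k and l is absorbed by the column sum with sign -1 and, moved across g, by
the row sum with sign +1. -/
theorem rowSum_mul_single_mul_colSum_eq_zero {n : ℕ} {γ μ : ℕ →₀ ℕ} {g : Equiv.Perm (Fin n)}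
    {k l : Fin n} (hkl : k ≠ l) (hc : colOf μ k = colOf μ l)
    (hr : rowOf γ (g k) = rowOf γ (g l)) :
    rowSum n γ * MonoidAlgebra.single g 1 * colSum n μ = 0 := by
  apply eq_zero_of_eq_neg_self
  calc rowSum n γ * MonoidAlgebra.single g 1 * colSum n μ
      = rowSum n γ * MonoidAlgebra.single (Equiv.swap (g k) (g l)) 1 *
          MonoidAlgebra.single g 1 * colSum n μ := by rw [rowSum_mul_single (swap_mem_rowGroup hr)]
    _ = rowSum n γ * MonoidAlgebra.single g 1 *
          (MonoidAlgebra.single (Equiv.swap k l) 1 * colSum n μ) := by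
        rw [mul_assoc (rowSum n γ), MonoidAlgebra.single_mul_single,
          ← Equiv.mul_swap_eq_swap_mul, ← MonoidAlgebra.single_mul_single]
        simp only [mul_assoc]
    _ = -(rowSum n γ * MonoidAlgebra.single g 1 * colSum n μ) := by
        rw [single_mul_colSum (swap_mem_colGroup hc), Equiv.Perm.sign_swap hkl]; simp

theorem colSum_mul_single_mul_rowSum_eq_zero {n : ℕ} {γ μ : ℕ →₀ ℕ} {g : Equiv.Perm (Fin n)}
    {k l : Fin n} (hkl : k ≠ l) (hc : colOf μ (g k) = colOf μ (g l))
    (hr : rowOf γ k = rowOf γ l) :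
    colSum n μ * MonoidAlgebra.single g 1 * rowSum n γ = 0 := by
  apply eq_zero_of_eq_neg_self
  calc colSum n μ * MonoidAlgebra.single g 1 * rowSum n γ
      = colSum n μ * (MonoidAlgebra.single g 1 *
          (MonoidAlgebra.single (Equiv.swap k l) 1 * rowSum n γ)) := by
        rw [single_mul_rowSum (swap_mem_rowGroup hr), mul_assoc]
    _ = colSum n μ * MonoidAlgebra.single (Equiv.swap (g k) (g l)) 1 *
          (MonoidAlgebra.single g 1 * rowSum n γ) := by
        rw [← mul_assoc (MonoidAlgebra.single g _), MonoidAlgebra.single_mul_single,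
          Equiv.mul_swap_eq_swap_mul, ← MonoidAlgebra.single_mul_single]
        simp only [mul_assoc]
    _ = -(colSum n μ * MonoidAlgebra.single g 1 * rowSum n γ) := by
        rw [colSum_mul_single (swap_mem_colGroup hc),
          Equiv.Perm.sign_swap fun h => hkl (g.injective h)]
        simp [mul_assoc]

theorem sum_coeff_smul_single {G : Type*} [Fintype G] (x : MonoidAlgebra ℂ G) :
    x = ∑ g, x.coeff g • MonoidAlgebra.single g 1 := by
  conv_lhs => rw [← MonoidAlgebra.sum_coeff_single x, Finsupp.sum_fintype _ _ fun _ => by simp]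
  simp

theorem rowSum_mul_mul_colSum_eq_zero {n : ℕ} {γ μ : ℕ →₀ ℕ} (hγ : IsPartition γ n)
    (hμ : IsPartition μ n) (h : ¬ Dominated γ μ) (x : MonoidAlgebra ℂ (Equiv.Perm (Fin n))) :
    rowSum n γ * x * colSum n μ = 0 := by
  rw [sum_coeff_smul_single x, Finset.mul_sum, Finset.sum_mul]
  refine Finset.sum_eq_zero fun g _ => ?_
  obtain ⟨k, l, hkl, hc, hr⟩ := exists_same_row_same_col hγ hμ h g
  rw [mul_smul_comm, smul_mul_assoc, rowSum_mul_single_mul_colSum_eq_zero hkl hc hr, smul_zero]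

theorem colSum_mul_mul_rowSum_eq_zero {n : ℕ} {γ μ : ℕ →₀ ℕ} (hγ : IsPartition γ n)
    (hμ : IsPartition μ n) (h : ¬ Dominated γ μ) (x : MonoidAlgebra ℂ (Equiv.Perm (Fin n))) :
    colSum n μ * x * rowSum n γ = 0 := by
  rw [sum_coeff_smul_single x, Finset.mul_sum, Finset.sum_mul]
  refine Finset.sum_eq_zero fun g _ => ?_
  obtain ⟨k, l, hkl, hc, hr⟩ := exists_same_row_same_col hγ hμ h g⁻¹
  rw [mul_smul_comm, smul_mul_assoc,
    colSum_mul_single_mul_rowSum_eq_zero (k := g⁻¹ k) (l := g⁻¹ l) (by simpa using hkl)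
      (by simpa using hc) hr, smul_zero]

/-- Young symmetrizers of different shapes annihilate each other. -/
theorem youngSymmetrizer_mul_mul_eq_zero {n : ℕ} {γ μ : ℕ →₀ ℕ} (hγ : IsPartition γ n)
    (hμ : IsPartition μ n) (h : γ ≠ μ) (x : MonoidAlgebra ℂ (Equiv.Perm (Fin n))) :
    youngSymmetrizer n γ * x * youngSymmetrizer n μ = 0 := by
  rw [youngSymmetrizer_eq, youngSymmetrizer_eq]
  by_cases h1 : Dominated γ μ
  · have h2 : ¬ Dominated μ γ := fun h2 => h (h1.antisymm h2)
    have := colSum_mul_mul_rowSum_eq_zero hμ hγ h2 x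
    calc rowSum n γ * colSum n γ * x * (rowSum n μ * colSum n μ)
        = rowSum n γ * (colSum n γ * x * rowSum n μ) * colSum n μ := by simp only [mul_assoc]
      _ = 0 := by rw [this]; simp
  · have := rowSum_mul_mul_colSum_eq_zero hγ hμ h1 (colSum n γ * x * rowSum n μ)
    rw [← this]; simp only [mul_assoc]

/-- For a group element g, either two points of one column land in one row and the product vanishes,
or g = r q with r in the row group and q in the column group. -/
theorem exists_rowSum_mul_mul_colSum {n : ℕ} {μ : ℕ →₀ ℕ} (hμ : IsPartition μ n)
    (x : MonoidAlgebra ℂ (Equiv.Perm (Fin n))) :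
    ∃ z : ℂ, rowSum n μ * x * colSum n μ = z • youngSymmetrizer n μ := by
  have hg : ∀ g : Equiv.Perm (Fin n), ∃ z : ℂ,
      rowSum n μ * MonoidAlgebra.single g 1 * colSum n μ = z • youngSymmetrizer n μ := by
    intro g
    by_cases h : ColumnInjective μ fun k : Fin n => rowOf μ (g k)
    · obtain ⟨q, hq, hgq⟩ := h.exists_colGroup hμ (card_rowOf_perm_lt hμ g)
      have hr : g * q⁻¹ ∈ rowGroup n μ := fun m => by
        rw [Equiv.Perm.mul_apply, hgq]; simp
      refine ⟨((Equiv.Perm.sign q : ℤ) : ℂ), ?_⟩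
      have : (MonoidAlgebra.single g 1 : MonoidAlgebra ℂ (Equiv.Perm (Fin n))) =
          MonoidAlgebra.single (g * q⁻¹) 1 * MonoidAlgebra.single q 1 := by
        rw [MonoidAlgebra.single_mul_single]; simp
      rw [this, ← mul_assoc, rowSum_mul_single hr, mul_assoc, single_mul_colSum hq, mul_smul_comm,
        youngSymmetrizer_eq]
    · unfold ColumnInjective at h
      push Not at h
      obtain ⟨k, l, hc, hr, hkl⟩ := h
      exact ⟨0, by rw [rowSum_mul_single_mul_colSum_eq_zero hkl hc hr, zero_smul]⟩
  choose z hz using hg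
  refine ⟨∑ g, x.coeff g * z g, ?_⟩
  conv_lhs => rw [sum_coeff_smul_single x, Finset.mul_sum, Finset.sum_mul]
  rw [Finset.sum_smul]
  refine Finset.sum_congr rfl fun g _ => ?_
  rw [mul_smul_comm, smul_mul_assoc, hz, smul_smul]

theorem exists_youngSymmetrizer_mul_mul {n : ℕ} {μ : ℕ →₀ ℕ} (hμ : IsPartition μ n)
    (x : MonoidAlgebra ℂ (Equiv.Perm (Fin n))) :
    ∃ z : ℂ, youngSymmetrizer n μ * x * youngSymmetrizer n μ = z • youngSymmetrizer n μ := by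
  obtain ⟨z, hz⟩ := exists_rowSum_mul_mul_colSum hμ (colSum n μ * x * rowSum n μ)
  refine ⟨z, ?_⟩
  rw [← hz, youngSymmetrizer_eq]
  simp only [mul_assoc]

open scoped Classical in
theorem youngSymmetrizer_eq_sum (n : ℕ) (μ : ℕ →₀ ℕ) :
    youngSymmetrizer n μ = ∑ r with r ∈ rowGroup n μ, ∑ q with q ∈ colGroup n μ,
      MonoidAlgebra.single (r * q) ((Equiv.Perm.sign q : ℤ) : ℂ) := by
  rw [youngSymmetrizer_eq, rowSum, colSum, Finset.sum_mul_sum]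
  simp only [MonoidAlgebra.single_mul_single, one_mul]

theorem coeff_one_youngSymmetrizer {n : ℕ} {μ : ℕ →₀ ℕ} (hμ : IsPartition μ n) :
    (youngSymmetrizer n μ).coeff 1 = 1 := by
  classical
  rw [youngSymmetrizer_eq_sum, MonoidAlgebra.coeff_sum, Finsupp.finsetSum_apply,
    Finset.sum_eq_single_of_mem 1 (by simp [one_mem]), MonoidAlgebra.coeff_sum,
    Finsupp.finsetSum_apply, Finset.sum_eq_single_of_mem 1 (by simp [one_mem])]
  · simp
  · intro q _ hq
    rw [MonoidAlgebra.coeff_single, Finsupp.single_apply, if_neg (by simpa using hq)]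
  · intro r hr hr1
    rw [MonoidAlgebra.coeff_sum, Finsupp.finsetSum_apply]
    refine Finset.sum_eq_zero fun q hq => ?_
    rw [MonoidAlgebra.coeff_single, Finsupp.single_apply, if_neg]
    intro h
    simp only [Finset.mem_filter, Finset.mem_univ, true_and] at hr hq
    rw [← inv_eq_iff_mul_eq_one] at h
    exact hr1 (eq_one_of_mem_rowGroup_of_mem_colGroup hμ hr (by
      rw [← inv_mem_iff, h]; exact hq))

/-! ### Characters of Specht modules -/

/-- The scalar by which the Young symmetrizer differs from an idempotent. -/
noncomputable def hookScalar (n : ℕ) (μ : ℕ →₀ ℕ) : ℂ :=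
  (youngSymmetrizer n μ * youngSymmetrizer n μ).coeff 1

theorem youngSymmetrizer_mul_mul {n : ℕ} {μ : ℕ →₀ ℕ} (hμ : IsPartition μ n)
    (x : MonoidAlgebra ℂ (Equiv.Perm (Fin n))) :
    youngSymmetrizer n μ * x * youngSymmetrizer n μ =
      (youngSymmetrizer n μ * x * youngSymmetrizer n μ).coeff 1 • youngSymmetrizer n μ := by
  obtain ⟨z, hz⟩ := exists_youngSymmetrizer_mul_mul hμ x
  rw [hz, MonoidAlgebra.coeff_smul_apply, coeff_one_youngSymmetrizer hμ, smul_eq_mul, mul_one]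

theorem youngSymmetrizer_mul_self {n : ℕ} {μ : ℕ →₀ ℕ} (hμ : IsPartition μ n) :
    youngSymmetrizer n μ * youngSymmetrizer n μ = hookScalar n μ • youngSymmetrizer n μ := by
  have := youngSymmetrizer_mul_mul hμ 1
  rwa [mul_one] at this

theorem trace_mulRight {G : Type*} [Group G] [Fintype G] (c : MonoidAlgebra ℂ G) :
    LinearMap.trace ℂ (MonoidAlgebra ℂ G) (LinearMap.mulRight ℂ c) =
      Fintype.card G * c.coeff 1 := by
  classical
  let b : Module.Basis G ℂ (MonoidAlgebra ℂ G) := .ofRepr (MonoidAlgebra.coeffLinearEquiv ℂ)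
  have hb : ∀ g, b g = MonoidAlgebra.single g 1 := fun g => by
    apply b.repr.injective
    rw [b.repr_self]; rfl
  rw [LinearMap.trace_eq_matrix_trace ℂ b, Matrix.trace]
  have : ∀ g, (LinearMap.toMatrix b b (LinearMap.mulRight ℂ c)).diag g = c.coeff 1 := fun g => by
    rw [Matrix.diag_apply, LinearMap.toMatrix_apply, LinearMap.mulRight_apply, hb]
    change (MonoidAlgebra.single g 1 * c).coeff g = _
    rw [MonoidAlgebra.coeff_single_mul_apply]; simp
  rw [Finset.sum_congr rfl fun g _ => this g]
  simp

/-- If c² = 0, right multiplication by c is nilpotent and has trace 0; but that trace is the group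
order times the coefficient of c at 1, which is 1. -/
theorem hookScalar_ne_zero {n : ℕ} {μ : ℕ →₀ ℕ} (hμ : IsPartition μ n) :
    hookScalar n μ ≠ 0 := by
  intro h
  have hc := youngSymmetrizer_mul_self hμ
  rw [h, zero_smul] at hc
  have hnil : IsNilpotent (LinearMap.mulRight ℂ (youngSymmetrizer n μ)) := by
    refine ⟨2, LinearMap.ext fun x => ?_⟩
    rw [sq, Module.End.mul_apply, LinearMap.mulRight_apply, LinearMap.mulRight_apply, mul_assoc, hc,
      mul_zero, LinearMap.zero_apply]
  have h0 := (LinearMap.isNilpotent_trace_of_isNilpotent hnil).eq_zero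
  rw [trace_mulRight, coeff_one_youngSymmetrizer hμ, mul_one] at h0
  exact Fintype.card_ne_zero (Nat.cast_eq_zero.1 h0)

/-- The character of the Specht module, extended to the group algebra by linearity. -/
noncomputable def zetaLin (n : ℕ) (μ : ℕ →₀ ℕ) :
    MonoidAlgebra ℂ (Equiv.Perm (Fin n)) →ₗ[ℂ] ℂ :=
  (hookScalar n μ)⁻¹ • (LinearMap.trace ℂ (MonoidAlgebra ℂ (Equiv.Perm (Fin n)))) ∘ₗ
    (LinearMap.mulRight ℂ (LinearMap.mulRight ℂ (youngSymmetrizer n μ) :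
      Module.End ℂ (MonoidAlgebra ℂ (Equiv.Perm (Fin n))))) ∘ₗ
    (LinearMap.mul ℂ (MonoidAlgebra ℂ (Equiv.Perm (Fin n))))

theorem zetaLin_apply (n : ℕ) (μ : ℕ →₀ ℕ) (x : MonoidAlgebra ℂ (Equiv.Perm (Fin n))) :
    zetaLin n μ x = (hookScalar n μ)⁻¹ * LinearMap.trace ℂ _
      (LinearMap.mulLeft ℂ x ∘ₗ LinearMap.mulRight ℂ (youngSymmetrizer n μ)) := rfl

/-- The map x ↦ h⁻¹ σ x c sends the group algebra into the Specht module and, because c² = h c,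
restricts there to the action of σ. Its trace on the whole algebra is therefore the trace on the
submodule. -/
theorem zeta_eq_zetaLin {n : ℕ} {μ : ℕ →₀ ℕ} (hμ : IsPartition μ n) (σ : Equiv.Perm (Fin n)) :
    zeta n μ σ = zetaLin n μ (MonoidAlgebra.single σ 1) := by
  set c := youngSymmetrizer n μ with hc
  have hh := hookScalar_ne_zero hμ
  let p : Submodule ℂ (MonoidAlgebra ℂ (Equiv.Perm (Fin n))) :=
    (spechtModule n μ).restrictScalars ℂ
  let f : Module.End ℂ (MonoidAlgebra ℂ (Equiv.Perm (Fin n))) :=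
    (hookScalar n μ)⁻¹ • (LinearMap.mulLeft ℂ (MonoidAlgebra.single σ 1) ∘ₗ
      LinearMap.mulRight ℂ c)
  have hfa : ∀ x, f x = (hookScalar n μ)⁻¹ • (MonoidAlgebra.single σ 1 * (x * c)) := fun x => rfl
  have hf : ∀ x, f x ∈ p := fun x => by
    rw [hfa, ← mul_assoc]
    exact p.smul_mem _ (Ideal.mul_mem_left _ _ (Ideal.subset_span rfl))
  have htr := LinearMap.trace_restrict_eq_of_forall_mem p f hf
  rw [zetaLin_apply, ← smul_eq_mul, ← map_smul]
  refine Eq.trans ?_ htr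
  rw [zeta, Representation.character]
  change LinearMap.trace ℂ p _ = _
  congr 1
  ext1 ⟨x, hx⟩
  apply Subtype.ext
  change MonoidAlgebra.single σ 1 * x = f x
  obtain ⟨y, rfl⟩ := Ideal.mem_span_singleton'.1 (show x ∈ Ideal.span {c} from hx)
  rw [hfa, mul_assoc y, hc, youngSymmetrizer_mul_self hμ, mul_smul_comm, mul_smul_comm, smul_smul,
    inv_mul_cancel₀ hh, one_smul]

theorem zetaLin_youngSymmetrizer_of_ne {n : ℕ} {γ μ : ℕ →₀ ℕ} (hγ : IsPartition γ n)
    (hμ : IsPartition μ n) (h : γ ≠ μ) : zetaLin n μ (youngSymmetrizer n γ) = 0 := by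
  rw [zetaLin_apply]
  have : LinearMap.mulLeft ℂ (youngSymmetrizer n γ) ∘ₗ
      LinearMap.mulRight ℂ (youngSymmetrizer n μ) = 0 := LinearMap.ext fun x => by
    rw [LinearMap.comp_apply, LinearMap.mulRight_apply, LinearMap.mulLeft_apply, ← mul_assoc,
      youngSymmetrizer_mul_mul_eq_zero hγ hμ h, LinearMap.zero_apply]
  rw [this, map_zero, mul_zero]

/-- The map x ↦ c x c has rank one: it is φ(x) c with φ(x) the coefficient of c x c at 1. Its trace
is φ(c) = h². -/
theorem zetaLin_youngSymmetrizer_self {n : ℕ} {μ : ℕ →₀ ℕ} (hμ : IsPartition μ n) :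
    zetaLin n μ (youngSymmetrizer n μ) = hookScalar n μ := by
  set c := youngSymmetrizer n μ with hc
  have hh := hookScalar_ne_zero hμ
  let φ : MonoidAlgebra ℂ (Equiv.Perm (Fin n)) →ₗ[ℂ] ℂ :=
    (Finsupp.lapply 1) ∘ₗ (MonoidAlgebra.coeffLinearEquiv ℂ).toLinearMap ∘ₗ
      LinearMap.mulLeft ℂ c ∘ₗ LinearMap.mulRight ℂ c
  have hφ : ∀ x, φ x = (c * x * c).coeff 1 := fun x => by rw [mul_assoc]; rfl
  have : LinearMap.mulLeft ℂ c ∘ₗ LinearMap.mulRight ℂ c = φ.smulRight c :=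
    LinearMap.ext fun x => by
      rw [LinearMap.comp_apply, LinearMap.mulRight_apply, LinearMap.mulLeft_apply, ← mul_assoc,
        LinearMap.smulRight_apply, hφ, hc, ← youngSymmetrizer_mul_mul hμ]
  rw [zetaLin_apply, ← hc, this, LinearMap.trace_smulRight, hφ, hc, youngSymmetrizer_mul_self hμ,
    smul_mul_assoc, youngSymmetrizer_mul_self hμ, MonoidAlgebra.coeff_smul_apply,
    MonoidAlgebra.coeff_smul_apply, coeff_one_youngSymmetrizer hμ]
  simp [hh]

theorem sum_coeff_mul_zeta {n : ℕ} {μ : ℕ →₀ ℕ} (hμ : IsPartition μ n)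
    (x : MonoidAlgebra ℂ (Equiv.Perm (Fin n))) :
    ∑ g, x.coeff g * zeta n μ g = zetaLin n μ x := by
  conv_rhs => rw [sum_coeff_smul_single x, map_sum]
  simp only [map_smul, zeta_eq_zetaLin hμ, smul_eq_mul]

/-! ### A partition for each conjugacy class -/

/-- The sequence conjugate to a multiset of positive integers. -/
noncomputable def conjSeq (s : Multiset ℕ) : ℕ →₀ ℕ :=
  Finsupp.onFinset (Finset.range s.sum) (fun i => (s.filter (i < ·)).card) fun i hi => by
    obtain ⟨a, ha⟩ := Multiset.card_pos_iff_exists_mem.1 (Nat.pos_of_ne_zero hi)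
    rw [Multiset.mem_filter] at ha
    exact Finset.mem_range.2 (ha.2.trans_le (Multiset.le_sum_of_mem ha.1))

theorem conjSeq_apply (s : Multiset ℕ) (i : ℕ) : conjSeq s i = (s.filter (i < ·)).card := rfl

theorem sum_range_card_filter_lt (s : Multiset ℕ) (N : ℕ) (h : ∀ a ∈ s, a ≤ N) :
    ∑ i ∈ Finset.range N, (s.filter (i < ·)).card = s.sum := by
  induction s using Multiset.induction_on with
  | empty => simp
  | cons a s ih =>
    have ha : ∑ i ∈ Finset.range N, (if i < a then 1 else 0) = a := by
      rw [← Finset.sum_filter, Finset.sum_const, smul_eq_mul, mul_one]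
      have : (Finset.range N).filter (· < a) = Finset.range a := by
        ext i
        have := h a (Multiset.mem_cons_self a s)
        simp only [Finset.mem_filter, Finset.mem_range]; omega
      rw [this, Finset.card_range]
    rw [Multiset.sum_cons, ← ih fun b hb => h b (Multiset.mem_cons_of_mem hb)]
    nth_rewrite 2 [← ha]
    rw [← Finset.sum_add_distrib]
    refine Finset.sum_congr rfl fun i _ => ?_
    rw [Multiset.filter_cons, Multiset.card_add]
    split_ifs <;> simp

theorem isPartition_conjSeq (s : Multiset ℕ) : IsPartition (conjSeq s) s.sum := by
  constructor
  · intro i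
    rw [conjSeq_apply, conjSeq_apply]
    exact Multiset.card_le_card
      (Multiset.monotone_filter_right s fun a h => (Nat.lt_succ_self i).trans h)
  · rw [Finsupp.degree_apply, ← sum_range_card_filter_lt s s.sum fun a ha =>
      Multiset.le_sum_of_mem ha]
    exact Finset.sum_subset Finsupp.support_onFinset_subset fun i _ hi => by simpa using hi

theorem card_filter_lt_eq (s : Multiset ℕ) (i : ℕ) :
    (s.filter (i < ·)).card = s.count (i + 1) + (s.filter (i + 1 < ·)).card := by
  induction s using Multiset.induction_on with
  | empty => simp
  | cons a s ih =>
    simp only [Multiset.filter_cons, Multiset.card_add, Multiset.count_cons, ih]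
    split_ifs <;> simp <;> omega

theorem conjSeq_injOn {s t : Multiset ℕ} (hs : 0 ∉ s) (ht : 0 ∉ t) (h : conjSeq s = conjSeq t) :
    s = t := by
  ext a
  cases a with
  | zero => rw [Multiset.count_eq_zero_of_notMem hs, Multiset.count_eq_zero_of_notMem ht]
  | succ i =>
    have h1 := card_filter_lt_eq s i
    have h2 := card_filter_lt_eq t i
    simp only [← conjSeq_apply, h] at h1 h2
    omega

/-- The conjugate of the cycle type needs no sorting. An injection suffices: only one shape per
class is needed to separate class functions. -/
theorem exists_partition_of_conjClasses (n : ℕ) :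
    ∃ ι : ConjClasses (Equiv.Perm (Fin n)) → ℕ →₀ ℕ, Function.Injective ι ∧
      ∀ c, IsPartition (ι c) n := by
  choose r hr using ConjClasses.exists_rep (α := Equiv.Perm (Fin n))
  have h0 : ∀ c, 0 ∉ (r c).partition.parts := fun c h =>
    lt_irrefl _ ((r c).partition.parts_pos h)
  refine ⟨fun c => conjSeq (r c).partition.parts, fun c d hcd => ?_, fun c => ?_⟩
  · have := conjSeq_injOn (h0 c) (h0 d) hcd
    rw [← hr c, ← hr d, ConjClasses.mk_eq_mk_iff_isConj, Equiv.Perm.partition_eq_of_isConj]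
    exact Nat.Partition.ext this
  · have := isPartition_conjSeq (r c).partition.parts
    exact ⟨this.1, this.2.trans ((r c).partition.parts_sum.trans (Fintype.card_fin n))⟩

theorem zeta_conj (n : ℕ) (μ : ℕ →₀ ℕ) {g h : Equiv.Perm (Fin n)} (hgh : IsConj g h) :
    zeta n μ g = zeta n μ h := by
  obtain ⟨u, rfl⟩ := isConj_iff.1 hgh
  exact (Representation.char_conj _ _ _).symm

/-- A class function is determined by its values at the Young symmetrizers. -/
theorem eq_zero_of_forall_youngSymmetrizer {n : ℕ} {F : Equiv.Perm (Fin n) → ℂ}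
    (hF : ∀ g h, IsConj g h → F g = F h)
    (h0 : ∀ μ, IsPartition μ n → ∑ g, (youngSymmetrizer n μ).coeff g * F g = 0) : F = 0 := by
  classical
  obtain ⟨ι, hι, hp⟩ := exists_partition_of_conjClasses n
  let Φ : (ConjClasses (Equiv.Perm (Fin n)) → ℂ) →ₗ[ℂ] (ConjClasses (Equiv.Perm (Fin n)) → ℂ) :=
    { toFun := fun f c => ∑ g, (youngSymmetrizer n (ι c)).coeff g * f (ConjClasses.mk g)
      map_add' := fun f f' => by
        ext c; simp only [Pi.add_apply, mul_add, Finset.sum_add_distrib]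
      map_smul' := fun z f => by
        ext c
        simp only [Pi.smul_apply, smul_eq_mul, RingHom.id_apply, Finset.mul_sum]
        exact Finset.sum_congr rfl fun g _ => mul_left_comm _ _ _ }
  let χ : ConjClasses (Equiv.Perm (Fin n)) → ConjClasses (Equiv.Perm (Fin n)) → ℂ :=
    fun c => Quotient.lift (zeta n (ι c)) fun g h hgh => zeta_conj n (ι c) hgh
  have hχ : ∀ c d, Φ (χ c) d = if c = d then hookScalar n (ι d) else 0 := by
    intro c d
    change ∑ g, (youngSymmetrizer n (ι d)).coeff g * zeta n (ι c) g = _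
    rw [sum_coeff_mul_zeta (hp c)]
    split_ifs with h
    · rw [h, zetaLin_youngSymmetrizer_self (hp d)]
    · exact zetaLin_youngSymmetrizer_of_ne (hp d) (hp c) fun h' => h (hι h').symm
  -- The characters χ c are sent to nonzero multiples of the standard basis. Surjectivity then gives
  -- injectivity, by finite dimension.
  have hsurj : Function.Surjective Φ := by
    intro v
    refine ⟨∑ c, (v c * (hookScalar n (ι c))⁻¹) • χ c, ?_⟩
    ext d
    rw [map_sum, Finset.sum_apply, Finset.sum_eq_single d]
    · rw [map_smul, Pi.smul_apply, hχ, if_pos rfl, smul_eq_mul, mul_assoc,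
        inv_mul_cancel₀ (hookScalar_ne_zero (hp d)), mul_one]
    · intro c _ hc
      rw [map_smul, Pi.smul_apply, hχ, if_neg hc, smul_zero]
    · simp
  have hinj := LinearMap.injective_iff_surjective.2 hsurj
  let f : ConjClasses (Equiv.Perm (Fin n)) → ℂ := Quotient.lift F hF
  have hf : f = 0 := by
    apply hinj
    rw [map_zero]
    ext c
    exact h0 (ι c) (hp c)
  ext g
  exact congrFun hf (ConjClasses.mk g)

/-! ### Exponents of colorings -/

/-- The sequence that extends a vector by zeros. -/
noncomputable def extend {L : ℕ} (a : Fin L →₀ ℕ) : ℕ →₀ ℕ :=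
  a.embDomain Fin.valEmbedding

theorem extend_apply {L : ℕ} (a : Fin L →₀ ℕ) (i : Fin L) : extend a i = a i :=
  Finsupp.embDomain_apply_self Fin.valEmbedding a i

theorem extend_of_le {L : ℕ} (a : Fin L →₀ ℕ) {i : ℕ} (hi : L ≤ i) : extend a i = 0 := by
  refine Finsupp.embDomain_of_notMem_range _ _ _ ?_
  rintro ⟨k, hk⟩
  exact absurd k.2 (not_lt.2 (hi.trans_eq hk.symm))

theorem sum_range_eq_sum_fin {L : ℕ} {γ : ℕ → ℕ} (hγ : ∀ i, L ≤ i → γ i = 0) (j : ℕ) :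
    ∑ i ∈ Finset.range j, γ i = ∑ i : Fin L with i.val < j, γ i := by
  have h1 : ∑ i ∈ Finset.range j, γ i = ∑ i ∈ (Finset.range L).filter (· < j), γ i := by
    refine (Finset.sum_subset (fun i hi => ?_) fun i hi hi' => hγ i ?_).symm
    · simp only [Finset.mem_filter, Finset.mem_range] at hi ⊢; exact hi.2
    · simp only [Finset.mem_filter, Finset.mem_range] at hi hi'; omega
  rw [h1, Finset.sum_filter, Finset.sum_filter, Finset.sum_range]

theorem partialSum_extend {L : ℕ} (a : Fin L →₀ ℕ) (j : ℕ) :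
    partialSum (extend a) j = ∑ i : Fin L with i.val < j, a i := by
  rw [partialSum, sum_range_eq_sum_fin fun i hi => extend_of_le a hi]
  simp only [extend_apply]

/-- The numbers of points of each color. -/
noncomputable def content {n L : ℕ} (f : Fin n → Fin L) : Fin L →₀ ℕ :=
  ∑ k, Finsupp.single (f k) 1

theorem wt_eq_monomial {n L : ℕ} (f : Fin n → Fin L) : wt f = monomial (content f) 1 := by
  rw [content, monomial_sum_one]; rfl

theorem partialSum_content {n L : ℕ} (f : Fin n → Fin L) (j : ℕ) :
    partialSum (extend (content f)) j = (Finset.univ.filter fun k => (f k).val < j).card := by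
  rw [partialSum_extend, Finset.card_filter]
  simp only [content, Finsupp.finsetSum_apply]
  rw [Finset.sum_comm]
  refine Finset.sum_congr rfl fun k _ => ?_
  rw [Finset.sum_filter, Finset.sum_eq_single (f k)]
  · simp
  · intro b _ hb; simp [Ne.symm hb]
  · simp

theorem content_comp_perm {n L : ℕ} (f : Fin n → Fin L) (g : Equiv.Perm (Fin n)) :
    content (f ∘ g) = content f :=
  Equiv.sum_comp g fun k => Finsupp.single (f k) 1

theorem coeff_fixPoly {n L : ℕ} (a : Fin L →₀ ℕ) (g : Equiv.Perm (Fin n)) :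
    coeff a (fixPoly L g) =
      ∑ f : Fin n → Fin L with content f = a, if ∀ m, f (g m) = f m then (1 : ℂ) else 0 := by
  classical
  rw [fixPoly, coeff_sum, Finset.sum_filter, Finset.sum_filter]
  refine Finset.sum_congr rfl fun f _ => ?_
  rw [wt_eq_monomial, coeff_monomial]
  split_ifs <;> rfl

/-! ### Evaluation of class functions at Young symmetrizers -/

open scoped Classical in
theorem sum_coeff_youngSymmetrizer_mul {n : ℕ} (μ : ℕ →₀ ℕ) (F : Equiv.Perm (Fin n) → ℂ) :
    ∑ g, (youngSymmetrizer n μ).coeff g * F g = ∑ r with r ∈ rowGroup n μ,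
      ∑ q with q ∈ colGroup n μ, ((Equiv.Perm.sign q : ℤ) : ℂ) * F (r * q) := by
  simp only [youngSymmetrizer_eq_sum, MonoidAlgebra.coeff_sum, Finsupp.finsetSum_apply,
    Finset.sum_mul, MonoidAlgebra.coeff_single]
  rw [Finset.sum_comm]
  refine Finset.sum_congr rfl fun r _ => ?_
  rw [Finset.sum_comm]
  refine Finset.sum_congr rfl fun q _ => ?_
  rw [Finset.sum_eq_single (r * q)]
  · rw [Finsupp.single_eq_same]
  · intro g _ hg
    rw [Finsupp.single_eq_of_ne hg, zero_mul]
  · simp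

open scoped Classical in
-- Two points of one column with the same color give a transposition fixing f; left multiplication
-- by it pairs the terms with opposite signs.
theorem sum_colGroup_eq_zero {n L : ℕ} {μ : ℕ →₀ ℕ} {f f' : Fin n → Fin L}
    (hf : ¬ ColumnInjective μ fun k => (f k).val) :
    ∑ q with q ∈ colGroup n μ, ((Equiv.Perm.sign q : ℤ) : ℂ) *
      (if ∀ m, f (q m) = f' m then (1 : ℂ) else 0) = 0 := by
  unfold ColumnInjective at hf
  push Not at hf
  obtain ⟨k, l, hc, hr, hkl⟩ := hf
  have ht := swap_mem_colGroup (n := n) hc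
  have hft : ∀ m, f (Equiv.swap k l m) = f m := fun m => by
    rw [Equiv.swap_apply_def]
    split_ifs with h1 h2
    · rw [h1]; exact (Fin.ext hr).symm
    · rw [h2]; exact Fin.ext hr
    · rfl
  apply eq_zero_of_eq_neg_self
  rw [← Finset.sum_neg_distrib]
  refine Finset.sum_nbij' (fun q => Equiv.swap k l * q) (fun q => Equiv.swap k l * q)
    ?_ ?_ ?_ ?_ ?_
  · intro q hq
    simp only [Finset.mem_filter, Finset.mem_univ, true_and] at hq ⊢
    exact mul_mem ht hq
  · intro q hq
    simp only [Finset.mem_filter, Finset.mem_univ, true_and] at hq ⊢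
    exact mul_mem ht hq
  · intro q _; simp
  · intro q _; simp
  · intro q _
    simp only [Equiv.Perm.sign_mul, Equiv.Perm.sign_swap hkl, Equiv.Perm.mul_apply, hft]
    rw [← neg_mul]; simp

/-- Only colorings injective on the columns of μ survive the signed column sum, and their content is
dominated by μ. -/
theorem coeff_youngSymmetrizer_eq_zero {n L : ℕ} {μ : ℕ →₀ ℕ} (hμ : IsPartition μ n)
    {a : Fin L →₀ ℕ} (h : ¬ Dominated (extend a) μ) :
    ∑ g, (youngSymmetrizer n μ).coeff g * coeff a (fixPoly L g) = 0 := by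
  classical
  rw [sum_coeff_youngSymmetrizer_mul]
  refine Finset.sum_eq_zero fun r _ => ?_
  simp only [coeff_fixPoly, Finset.mul_sum]
  rw [Finset.sum_comm]
  refine Finset.sum_eq_zero fun f hf => ?_
  simp only [Equiv.Perm.mul_apply]
  refine sum_colGroup_eq_zero (f := fun k => f (r k)) fun hinj => h fun j => ?_
  have hfr : content (f ∘ r) = a := (content_comp_perm f r).trans (Finset.mem_filter.1 hf).2
  rw [← hfr, partialSum_content]
  exact hinj.card_lt_le hμ j

open scoped Classical in
theorem hookScalar_eq_sum (n : ℕ) (μ : ℕ →₀ ℕ) :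
    hookScalar n μ = ∑ p with p ∈ colGroup n μ, ∑ r with r ∈ rowGroup n μ,
      ∑ q with q ∈ colGroup n μ, ((Equiv.Perm.sign q : ℤ) : ℂ) *
        (if p * q * r * p⁻¹ ∈ rowGroup n μ then (1 : ℂ) else 0) := by
  have hrow : ∀ y : MonoidAlgebra ℂ (Equiv.Perm (Fin n)), (rowSum n μ * y).coeff 1 =
      ∑ r with r ∈ rowGroup n μ, y.coeff r := fun y => by
    rw [rowSum, Finset.sum_mul, MonoidAlgebra.coeff_sum, Finsupp.finsetSum_apply]
    refine Finset.sum_nbij' (fun r => r⁻¹) (fun r => r⁻¹) ?_ ?_ ?_ ?_ ?_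
    · intro r hr; simpa using hr
    · intro r hr; simpa using hr
    · intro r _; simp
    · intro r _; simp
    · intro r _; rw [MonoidAlgebra.coeff_single_mul_apply]; simp
  have hexp : colSum n μ * (rowSum n μ * colSum n μ) = ∑ q' with q' ∈ colGroup n μ,
      ∑ r with r ∈ rowGroup n μ, ∑ q with q ∈ colGroup n μ, MonoidAlgebra.single (q * r * q')
        (((Equiv.Perm.sign q : ℤ) : ℂ) * ((Equiv.Perm.sign q' : ℤ) : ℂ)) := by
    rw [← mul_assoc, colSum, rowSum, Finset.sum_mul_sum, Finset.mul_sum]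
    refine Finset.sum_congr rfl fun q' _ => ?_
    rw [Finset.sum_comm, Finset.sum_mul]
    refine Finset.sum_congr rfl fun r _ => ?_
    rw [Finset.sum_mul]
    refine Finset.sum_congr rfl fun q _ => ?_
    rw [MonoidAlgebra.single_mul_single, MonoidAlgebra.single_mul_single, mul_one]
  rw [hookScalar, youngSymmetrizer_eq, mul_assoc, hrow, hexp]
  simp only [MonoidAlgebra.coeff_sum, Finsupp.finsetSum_apply, MonoidAlgebra.coeff_single]
  rw [Finset.sum_comm]
  refine Finset.sum_nbij' (fun p => p⁻¹) (fun p => p⁻¹) ?_ ?_ ?_ ?_ ?_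
  · intro r hr; simpa using hr
  · intro r hr; simpa using hr
  · intro r _; simp
  · intro r _; simp
  intro q' hq'
  rw [Finset.sum_comm]
  refine Finset.sum_congr rfl fun r _ => ?_
  rw [Finset.sum_comm]
  refine Finset.sum_nbij' (fun q => q' * q) (fun q => q'⁻¹ * q) ?_ ?_ ?_ ?_ ?_
  · intro q hq
    simp only [Finset.mem_filter, Finset.mem_univ, true_and] at hq hq' ⊢
    exact mul_mem hq' hq
  · intro q hq
    simp only [Finset.mem_filter, Finset.mem_univ, true_and] at hq hq' ⊢
    exact mul_mem (inv_mem hq') hq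
  · intro q _; simp
  · intro q _; simp
  · intro q _
    have hg : q'⁻¹ * (q' * q) * r * q'⁻¹⁻¹ = q * r * q' := by group
    rw [hg, Equiv.Perm.sign_mul]
    simp only [Finsupp.single_apply]
    rw [Finset.sum_ite_eq]
    simp only [Finset.mem_filter, Finset.mem_univ, true_and, mul_ite, mul_one, mul_zero]
    congr 1
    push_cast
    ring

/-- The surviving colorings of content μ are exactly the row coloring composed with column
permutations p, which matches `hookScalar_eq_sum` term by term. -/
theorem coeff_youngSymmetrizer_self {n L : ℕ} {μ : ℕ →₀ ℕ} (hμ : IsPartition μ n)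
    {a : Fin L →₀ ℕ} (ha : extend a = μ) :
    ∑ g, (youngSymmetrizer n μ).coeff g * coeff a (fixPoly L g) = hookScalar n μ := by
  classical
  have hrow : ∀ k : Fin n, rowOf μ k < L := fun k => by
    by_contra h
    have h1 := colOf_lt hμ k.2
    have h2 : ∀ i, L ≤ i → μ i = 0 := fun i hi => by rw [← ha]; exact extend_of_le a hi
    rw [h2 _ (not_lt.1 h)] at h1
    exact Nat.not_lt_zero _ h1
  let f₀ : Fin n → Fin L := fun k => ⟨rowOf μ k, hrow k⟩
  have hcont : ∀ f : Fin n → Fin L, content f = a ↔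
      ∀ j, (Finset.univ.filter fun k => (f k).val < j).card = partialSum μ j := by
    intro f
    constructor
    · intro h j; rw [← partialSum_content, h, ha]
    · intro h
      have : extend (content f) = extend a := by
        rw [ha]
        exact Dominated.antisymm (fun j => by rw [partialSum_content, h])
          (fun j => by rw [partialSum_content, h])
      exact Finsupp.embDomain_injective _ this
  rw [sum_coeff_youngSymmetrizer_mul, hookScalar_eq_sum]
  simp only [coeff_fixPoly, Finset.mul_sum]
  rw [Finset.sum_comm (s := Finset.univ.filter fun p => p ∈ colGroup n μ)]
  refine Finset.sum_congr rfl fun r hr => ?_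
  have hr' : r ∈ rowGroup n μ := (Finset.mem_filter.1 hr).2
  rw [Finset.sum_comm]
  -- Replacing f by f ∘ r preserves the content and isolates q, so that the cancellation over the
  -- column group applies.
  have h1 : ∑ f : Fin n → Fin L with content f = a, ∑ q with q ∈ colGroup n μ,
      ((Equiv.Perm.sign q : ℤ) : ℂ) * (if ∀ m, f ((r * q) m) = f m then (1 : ℂ) else 0) =
      ∑ f : Fin n → Fin L with content f = a, ∑ q with q ∈ colGroup n μ,
      ((Equiv.Perm.sign q : ℤ) : ℂ) * (if ∀ m, f (q m) = f (r⁻¹ m) then (1 : ℂ) else 0) := by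
    refine Finset.sum_nbij' (fun f => f ∘ r) (fun f => f ∘ ⇑r⁻¹) ?_ ?_ ?_ ?_ ?_
    · intro f hf
      simp only [Finset.mem_filter, Finset.mem_univ, true_and] at hf ⊢
      rw [content_comp_perm, hf]
    · intro f hf
      simp only [Finset.mem_filter, Finset.mem_univ, true_and] at hf ⊢
      rw [content_comp_perm, hf]
    · intro f _; ext; simp
    · intro f _; ext; simp
    · intro f _
      refine Finset.sum_congr rfl fun q _ => congrArg _ (if_congr ?_ rfl rfl)
      simp only [Function.comp_apply, Equiv.Perm.mul_apply,
        show ∀ m, r (r⁻¹ m) = m from r.apply_symm_apply]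
  rw [h1]
  symm
  refine Finset.sum_of_injOn (fun p : Equiv.Perm (Fin n) => f₀ ∘ p) ?_ ?_ ?_ ?_
  · intro p hp p' hp' h
    simp only [Finset.coe_filter, Set.mem_ofPred_eq, Finset.mem_univ, true_and] at hp hp'
    refine Equiv.ext fun k => cell_injective hμ ?_ ((hp k).trans (hp' k).symm)
    exact congrArg Fin.val (congrFun h k)
  · intro p _
    simp only [Finset.coe_filter, Set.mem_ofPred_eq, Finset.mem_univ, true_and]
    rw [hcont]
    exact card_rowOf_perm_lt hμ p
  · intro f hf hf'
    refine sum_colGroup_eq_zero fun hinj => hf' ?_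
    obtain ⟨q, hq, hfq⟩ := hinj.exists_colGroup hμ ((hcont f).1 (Finset.mem_filter.1 hf).2)
    refine ⟨q, by simpa using hq, ?_⟩
    ext k
    exact (hfq k).symm
  · intro p _
    -- Substituting m = r p⁻¹ m' turns equality of the rows of p q m and p r⁻¹ m into p q r p⁻¹
    -- preserving rows.
    refine Finset.sum_congr rfl fun q _ => ?_
    congr 2
    refine propext ⟨fun h m => ?_, fun h m => ?_⟩
    · have := h (p (r⁻¹ m))
      refine Fin.ext ?_
      simpa [f₀] using this
    · have := congrArg Fin.val (h (r (p⁻¹ m)))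
      simpa [f₀] using this

/-! ### The alternating formula for the characters -/

/-- The exponent vector `α + (L - 1, …, 1, 0)`. -/
noncomputable def shiftExp (L : ℕ) (α : ℕ →₀ ℕ) : Fin L →₀ ℕ :=
  Finsupp.equivFunOnFinite.symm fun i => α i + (i.rev : ℕ)

theorem shiftExp_apply {L : ℕ} (α : ℕ →₀ ℕ) (i : Fin L) : shiftExp L α i = α i + (i.rev : ℕ) := rfl

theorem sum_range_card_le_sum {ι : Type*} (s : Finset ι) {f : ι → ℕ} (hf : Set.InjOn f s) :
    ∑ i ∈ Finset.range s.card, i ≤ ∑ i ∈ s, f i := by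
  classical
  have hinj : Set.InjOn (fun i => (f i : ℤ)) s := fun i hi j hj h => hf hi hj (by simpa using h)
  have h := Finset.sum_range_le_sum (s := s.image fun i => (f i : ℤ)) (c := 0) (by simp)
  rw [Finset.card_image_of_injOn hinj, Finset.sum_image hinj] at h
  zify
  simpa using h

/-- The first j entries of δ are its j largest; passing to complements, j distinct naturals sum to
at least 0 + … + (j-1). -/
theorem sum_rev_perm_le {L : ℕ} (σ : Equiv.Perm (Fin L)) (j : ℕ) :
    ∑ i : Fin L with i.val < j, ((σ i).rev : ℕ) ≤ ∑ i : Fin L with i.val < j, (i.rev : ℕ) := by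
  have h1 : ∑ i : Fin L with i.val < j, i.val ≤ ∑ i : Fin L with i.val < j, (σ i).val := by
    refine le_trans (le_of_eq ?_) (sum_range_card_le_sum _
      (Set.injOn_of_injective (Fin.val_injective.comp σ.injective)))
    have hr : Finset.range (min L j) = (Finset.range L).filter (· < j) := by ext; simp
    rw [Fin.card_filter_val_lt, Finset.sum_filter, hr, Finset.sum_filter, Finset.sum_range]
  have h2 : ∀ τ : Equiv.Perm (Fin L), ∑ i : Fin L with i.val < j, ((τ i).rev : ℕ) +
      ∑ i : Fin L with i.val < j, (τ i).val = ∑ i : Fin L with i.val < j, (L - 1) := fun τ => by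
    rw [← Finset.sum_add_distrib]
    refine Finset.sum_congr rfl fun i _ => ?_
    have := (τ i).2
    rw [Fin.val_rev]; omega
  have h3 := h2 σ
  have h4 := h2 1
  simp only [Equiv.Perm.one_apply] at h4
  omega

theorem coeff_vander_mul {L : ℕ} (a : Fin L →₀ ℕ) (P : MvPolynomial (Fin L) ℂ) :
    coeff a (vander L * P) = ∑ σ : Equiv.Perm (Fin L),
      if vanderExp σ ≤ a then ((Equiv.Perm.sign σ : ℤ) : ℂ) * coeff (a - vanderExp σ) P else 0 := by
  classical
  rw [vander_eq_sum, Finset.sum_mul, coeff_sum]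
  exact Finset.sum_congr rfl fun σ _ => coeff_monomial_mul' _ _ _ _

/-- The partial sums of σδ are at most those of δ, so α + δ - σδ dominates α. -/
theorem dominated_extend_sub {L : ℕ} {α : ℕ →₀ ℕ} (hα : ∀ i, L ≤ i → α i = 0)
    {σ : Equiv.Perm (Fin L)} (hσ : vanderExp σ ≤ shiftExp L α) :
    Dominated α (extend (shiftExp L α - vanderExp σ)) := by
  intro j
  have h1 : ∑ i : Fin L with i.val < j, (shiftExp L α - vanderExp σ) i +
      ∑ i : Fin L with i.val < j, ((σ⁻¹ i).rev : ℕ) =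
      ∑ i : Fin L with i.val < j, α i + ∑ i : Fin L with i.val < j, (i.rev : ℕ) := by
    rw [← Finset.sum_add_distrib, ← Finset.sum_add_distrib]
    refine Finset.sum_congr rfl fun i _ => ?_
    rw [Finsupp.tsub_apply, ← vanderExp_apply, Nat.sub_add_cancel (hσ i), shiftExp_apply]
  rw [partialSum_extend, partialSum, sum_range_eq_sum_fin hα]
  have h2 := sum_rev_perm_le σ⁻¹ j
  omega

/-- The coefficient of the alternating formula for the character of `α`. -/
noncomputable def altCoeff {n : ℕ} (L : ℕ) (α : ℕ →₀ ℕ) (g : Equiv.Perm (Fin n)) : ℂ :=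
  coeff (shiftExp L α) (vander L * fixPoly L g)

theorem altCoeff_conj {n L : ℕ} (α : ℕ →₀ ℕ) {g h : Equiv.Perm (Fin n)} (hgh : IsConj g h) :
    altCoeff L α g = altCoeff L α h := by
  obtain ⟨u, rfl⟩ := isConj_iff.1 hgh
  rw [altCoeff, altCoeff, fixPoly_conj]

theorem sum_mul_altCoeff {n L : ℕ} (α : ℕ →₀ ℕ) (x : MonoidAlgebra ℂ (Equiv.Perm (Fin n))) :
    ∑ g, x.coeff g * altCoeff L α g = ∑ σ : Equiv.Perm (Fin L),
      if vanderExp σ ≤ shiftExp L α then ((Equiv.Perm.sign σ : ℤ) : ℂ) *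
        ∑ g, x.coeff g * coeff (shiftExp L α - vanderExp σ) (fixPoly L g) else 0 := by
  simp only [altCoeff, coeff_vander_mul, Finset.mul_sum]
  rw [Finset.sum_comm]
  refine Finset.sum_congr rfl fun σ _ => ?_
  split_ifs
  · exact Finset.sum_congr rfl fun g _ => mul_left_comm _ _ _
  · simp

theorem dominated_of_sum_mul_altCoeff_ne_zero {n L : ℕ} {α μ : ℕ →₀ ℕ} (hμ : IsPartition μ n)
    (hL : ∀ i, L ≤ i → α i = 0)
    (h : ∑ g : Equiv.Perm (Fin n), (youngSymmetrizer n μ).coeff g * altCoeff L α g ≠ 0) :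
    Dominated α μ := by
  by_contra hd
  apply h
  rw [sum_mul_altCoeff]
  refine Finset.sum_eq_zero fun σ _ => ?_
  split_ifs with hσ
  · rw [coeff_youngSymmetrizer_eq_zero hμ fun h => hd fun j =>
      (dominated_extend_sub hL hσ j).trans (h j), mul_zero]
  · rfl

theorem vanderExp_one_le {L : ℕ} (α : ℕ →₀ ℕ) : vanderExp 1 ≤ shiftExp L α := fun i => by
  rw [vanderExp_apply, shiftExp_apply, inv_one, Equiv.Perm.one_apply]; exact Nat.le_add_left _ _

theorem extend_shiftExp_sub {L : ℕ} {α : ℕ →₀ ℕ} (hL : ∀ i, L ≤ i → α i = 0) :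
    extend (shiftExp L α - vanderExp 1) = α := by
  ext i
  by_cases hi : i < L
  · rw [show i = (⟨i, hi⟩ : Fin L).val from rfl, extend_apply, Finsupp.tsub_apply, shiftExp_apply,
      vanderExp_apply, inv_one, Equiv.Perm.one_apply, Nat.add_sub_cancel]
  · rw [extend_of_le _ (not_lt.1 hi), hL _ (not_lt.1 hi)]

/-- A term with σ ≠ 1 could survive only if μ + δ - σδ were both dominated by μ and dominating μ,
which forces σδ = δ. -/
theorem sum_mul_altCoeff_self {n L : ℕ} {μ : ℕ →₀ ℕ} (hμ : IsPartition μ n)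
    (hL : ∀ i, L ≤ i → μ i = 0) :
    ∑ g : Equiv.Perm (Fin n), (youngSymmetrizer n μ).coeff g * altCoeff L μ g =
      hookScalar n μ := by
  rw [sum_mul_altCoeff, Finset.sum_eq_single 1, if_pos (vanderExp_one_le μ),
    coeff_youngSymmetrizer_self hμ (extend_shiftExp_sub hL)]
  · simp
  · intro σ _ hσ
    split_ifs with h
    · rw [coeff_youngSymmetrizer_eq_zero hμ, mul_zero]
      intro hd
      apply hσ
      have h1 := hd.antisymm (dominated_extend_sub hL h)
      have h2 : shiftExp L μ - vanderExp σ = shiftExp L μ - vanderExp 1 :=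
        Finsupp.embDomain_injective _ (h1.trans (extend_shiftExp_sub hL).symm)
      refine inv_injective (Equiv.ext fun i => ?_)
      have h3 := DFunLike.congr_fun h2 i
      rw [Finsupp.tsub_apply, Finsupp.tsub_apply] at h3
      have h4 := h i
      have h5 := vanderExp_one_le (L := L) μ i
      have h6 : vanderExp σ i = vanderExp 1 i := by omega
      rw [vanderExp_apply, vanderExp_apply] at h6
      exact Fin.rev_injective (Fin.ext h6)
    · rfl
  · simp

/-- The sum of all transpositions, together with `n` times the identity. -/
noncomputable def swapSum (n : ℕ) : MonoidAlgebra ℂ (Equiv.Perm (Fin n)) :=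
  ∑ k, ∑ l, MonoidAlgebra.single (Equiv.swap k l) 1

theorem swapSum_mul_comm {n : ℕ} (x : MonoidAlgebra ℂ (Equiv.Perm (Fin n))) :
    swapSum n * x = x * swapSum n := by
  rw [sum_coeff_smul_single x, Finset.mul_sum, Finset.sum_mul]
  refine Finset.sum_congr rfl fun g _ => ?_
  rw [mul_smul_comm, smul_mul_assoc]
  congr 1
  simp only [swapSum, Finset.mul_sum, Finset.sum_mul, MonoidAlgebra.single_mul_single]
  rw [← Equiv.sum_comp g]
  refine Finset.sum_congr rfl fun k _ => ?_
  rw [← Equiv.sum_comp g]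
  refine Finset.sum_congr rfl fun l _ => ?_
  rw [Equiv.mul_swap_eq_swap_mul]

/-- For the central element S, h S c = S c c = c S c, a multiple of c. -/
theorem exists_swapSum_mul_youngSymmetrizer {n : ℕ} {μ : ℕ →₀ ℕ} (hμ : IsPartition μ n) :
    ∃ κ : ℂ, swapSum n * youngSymmetrizer n μ = κ • youngSymmetrizer n μ := by
  obtain ⟨z, hz⟩ := exists_youngSymmetrizer_mul_mul hμ (swapSum n)
  refine ⟨(hookScalar n μ)⁻¹ * z, ?_⟩
  rw [mul_smul, ← hz, ← swapSum_mul_comm, mul_assoc, youngSymmetrizer_mul_self hμ, mul_smul_comm,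
    smul_smul, inv_mul_cancel₀ (hookScalar_ne_zero hμ), one_smul]

theorem sum_coeff_swapSum_mul {n : ℕ} (x : MonoidAlgebra ℂ (Equiv.Perm (Fin n)))
    (F : Equiv.Perm (Fin n) → ℂ) :
    ∑ g, (swapSum n * x).coeff g * F g =
      ∑ g, x.coeff g * ∑ k, ∑ l, F (Equiv.swap k l * g) := by
  simp only [swapSum, Finset.sum_mul, MonoidAlgebra.coeff_sum, Finsupp.finsetSum_apply,
    Finset.mul_sum, MonoidAlgebra.coeff_single_mul_apply, one_mul]
  rw [Finset.sum_comm, Finset.sum_comm (s := Finset.univ (α := Equiv.Perm (Fin n)))]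
  refine Finset.sum_congr rfl fun k _ => ?_
  rw [Finset.sum_comm, Finset.sum_comm (s := Finset.univ (α := Equiv.Perm (Fin n)))]
  refine Finset.sum_congr rfl fun l _ => ?_
  rw [← Equiv.sum_comp (Equiv.mulLeft (Equiv.swap k l))]
  simp

/-- The eigenvalue of the sum of all transpositions, up to a constant. -/
noncomputable def quadForm (n L : ℕ) (a : Fin L →₀ ℕ) : ℂ :=
  ∑ i, (a i : ℂ) ^ 2 - ((∑ i : Fin L, ((i : ℕ) : ℂ) ^ 2) + 2 * ((L : ℂ) - 1) * n)

/-- The transposition sum may act on c_μ or on the function paired with it; both give the same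
nonzero pairing times their eigenvalue. -/
theorem quadForm_eq_of_ne_zero {n L : ℕ} {α μ : ℕ →₀ ℕ} {κ : ℂ}
    (hκ : swapSum n * youngSymmetrizer n μ = κ • youngSymmetrizer n μ)
    (h : ∑ g : Equiv.Perm (Fin n), (youngSymmetrizer n μ).coeff g * altCoeff L α g ≠ 0) :
    quadForm n L (shiftExp L α) = κ := by
  have h1 := sum_coeff_swapSum_mul (youngSymmetrizer n μ) (altCoeff L α)
  rw [hκ] at h1
  simp only [altCoeff, sum_coeff_vander_fixPoly_swap] at h1
  simp only [MonoidAlgebra.coeff_smul_apply, smul_eq_mul] at h1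
  apply mul_right_cancel₀ h
  rw [Finset.mul_sum, Finset.mul_sum]
  refine Eq.trans ?_ (h1.symm.trans ?_)
  · exact Finset.sum_congr rfl fun g _ => mul_left_comm _ _ _
  · exact Finset.sum_congr rfl fun g _ => mul_assoc _ _ _

theorem abel_summation (D w : ℕ → ℤ) (h0 : D 0 = 0) (N : ℕ) :
    ∑ i ∈ Finset.range N, (D (i + 1) - D i) * w i =
      D N * w N + ∑ i ∈ Finset.range N, D (i + 1) * (w i - w (i + 1)) := by
  induction N with
  | zero => simp [h0]
  | succ N ih => rw [Finset.sum_range_succ, ih, Finset.sum_range_succ]; ring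

theorem eq_of_dominated_of_quadForm_eq {n L : ℕ} {α μ : ℕ →₀ ℕ} (hα : IsPartition α n)
    (hμ : IsPartition μ n) (hLα : ∀ i, L ≤ i → α i = 0) (hLμ : ∀ i, L ≤ i → μ i = 0)
    (hd : Dominated α μ)
    (hq : quadForm n L (shiftExp L α) = quadForm n L (shiftExp L μ)) : α = μ := by
  let D : ℕ → ℤ := fun j => partialSum μ j - partialSum α j
  -- For i < L this is the sum of the i-th entries of μ + δ and α + δ, so (D (i + 1) - D i) * w i is
  -- a difference of squares. As w drops by at least 2, Abel summation leaves nonnegative terms that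
  -- vanish only for D = 0.
  let w : ℕ → ℤ := fun i => μ i + α i + 2 * (L - 1 - i)
  have hD : ∀ j, 0 ≤ D j := fun j => by
    have := hd j
    simp only [D]; omega
  have hDL : ∀ j, L ≤ j → D j = 0 := fun j hj => by
    simp only [D]
    rw [partialSum_eq_degree fun k hk => hLα k (hj.trans hk),
      partialSum_eq_degree fun k hk => hLμ k (hj.trans hk), hα.2, hμ.2, sub_self]
  have hw : ∀ i, 2 ≤ w i - w (i + 1) := fun i => by
    have := hα.1 i; have := hμ.1 i
    simp only [w]; push_cast; omega
  have hsum : ∑ i ∈ Finset.range L, (D (i + 1) - D i) * w i = 0 := by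
    have hq' : (∑ i, (shiftExp L μ i : ℤ) ^ 2 - ∑ i, (shiftExp L α i : ℤ) ^ 2) = 0 := by
      rw [quadForm, quadForm, sub_left_inj] at hq
      rw [sub_eq_zero]
      exact_mod_cast hq.symm
    rw [← hq', Finset.sum_range, ← Finset.sum_sub_distrib]
    refine Finset.sum_congr rfl fun i _ => ?_
    have hr : ((i.rev : ℕ) : ℤ) = L - 1 - i := by
      have := i.2
      rw [Fin.val_rev]; omega
    simp only [D, w, shiftExp_apply, partialSum_succ]
    push_cast
    rw [hr]
    ring
  rw [abel_summation D w (by simp [D, partialSum]), hDL L le_rfl, zero_mul, zero_add,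
    Finset.sum_eq_zero_iff_of_nonneg fun i _ => mul_nonneg (hD _) (by linarith [hw i])] at hsum
  have hDz : ∀ j, D j = 0 := fun j => by
    rcases le_or_gt L j with hj | hj
    · exact hDL j hj
    · cases j with
      | zero => simp [D, partialSum]
      | succ j =>
        have := hsum j (Finset.mem_range.2 (by omega))
        exact (mul_eq_zero.1 this).resolve_right (by linarith [hw j])
  refine hd.antisymm fun j => ?_
  have := hDz j
  simp only [D] at this; omega

/-- The alternating formula for the irreducible characters of the symmetric group. -/
theorem zeta_eq_altCoeff {n L : ℕ} {α : ℕ →₀ ℕ} (hα : IsPartition α n)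
    (hL : ∀ i, L ≤ i → α i = 0) (g : Equiv.Perm (Fin n)) : zeta n α g = altCoeff L α g := by
  have key : ∀ μ, IsPartition μ n → ∑ g, (youngSymmetrizer n μ).coeff g *
      (zeta n α g - altCoeff L α g) = 0 := by
    intro μ hμ
    simp only [mul_sub, Finset.sum_sub_distrib]
    rw [sum_coeff_mul_zeta hα]
    by_cases h : μ = α
    · rw [h, zetaLin_youngSymmetrizer_self hα, sum_mul_altCoeff_self hα hL, sub_self]
    · rw [zetaLin_youngSymmetrizer_of_ne hμ hα h, zero_sub, neg_eq_zero]
      by_contra h0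
      have hd := dominated_of_sum_mul_altCoeff_ne_zero hμ hL h0
      -- By dominance the partial sums of μ have reached n already at i.
      have hLμ : ∀ i, L ≤ i → μ i = 0 := fun i hi => by
        have h1 := hd i
        rw [partialSum_eq_degree fun k hk => hL k (hi.trans hk), hα.2, ← hμ.2] at h1
        have h2 := partialSum_le_degree μ (i + 1)
        rw [partialSum_succ] at h2
        omega
      obtain ⟨κ, hκ⟩ := exists_swapSum_mul_youngSymmetrizer hμ
      refine h (eq_of_dominated_of_quadForm_eq hα hμ hL hLμ hd ?_).symm
      rw [quadForm_eq_of_ne_zero hκ h0, quadForm_eq_of_ne_zero hκ]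
      rw [sum_mul_altCoeff_self hμ hLμ]
      exact hookScalar_ne_zero hμ
  have := eq_zero_of_forall_youngSymmetrizer (F := fun g => zeta n α g - altCoeff L α g)
    (fun g h hgh => by rw [zeta_conj n α hgh, altCoeff_conj α hgh]) key
  exact sub_eq_zero.1 (congrFun this g)

/-! ### Invariant colorings of the standard permutations -/

theorem mem_block_iff {β : ℕ →₀ ℕ} {n : ℕ} (hβ : IsPartition β n) {j : ℕ} {k : Fin n} :
    k ∈ block n β j ↔ rowOf β k = j := by
  have h1 := rowOf_lt_iff (j := j) hβ k.2
  have h2 := rowOf_lt_iff (j := j + 1) hβ k.2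
  simp only [block, List.mem_filter, List.mem_finRange, true_and, decide_eq_true_eq]
  omega

theorem nodup_block (n : ℕ) (β : ℕ →₀ ℕ) (j : ℕ) : (block n β j).Nodup :=
  (List.nodup_finRange n).filter _

theorem rowOf_formPerm_block {β : ℕ →₀ ℕ} {n : ℕ} (hβ : IsPartition β n) (j : ℕ) (k : Fin n) :
    rowOf β ((block n β j).formPerm k) = rowOf β k := by
  by_cases hk : k ∈ block n β j
  · rw [(mem_block_iff hβ).1 hk, (mem_block_iff hβ).1 (List.formPerm_apply_mem_of_mem hk)]
  · rw [List.formPerm_apply_of_notMem hk]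

theorem prod_formPerm_block_apply {β : ℕ →₀ ℕ} {n : ℕ} (hβ : IsPartition β n) (N : ℕ)
    (k : Fin n) :
    ((List.range N).map fun j => (block n β j).formPerm).prod k =
      if rowOf β k < N then (block n β (rowOf β k)).formPerm k else k := by
  induction N generalizing k with
  | zero => simp
  | succ N ih =>
    rw [List.range_succ, List.map_append, List.prod_append, List.map_singleton, List.prod_singleton,
      Equiv.Perm.mul_apply, ih, rowOf_formPerm_block hβ]
    by_cases h : rowOf β k = N
    · rw [if_neg (by omega), if_pos (by omega), h]
    · rw [List.formPerm_apply_of_notMem fun hk => h ((mem_block_iff hβ).1 hk)]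
      by_cases h' : rowOf β k < N
      · rw [if_pos h', if_pos (by omega)]
      · rw [if_neg h', if_neg (by omega)]

theorem rowOf_lt_len {β : ℕ →₀ ℕ} {n : ℕ} (hβ : IsPartition β n) (k : Fin n) :
    rowOf β k < len β := by
  rw [rowOf_lt_iff hβ k.2, partialSum_eq_of_len_le le_rfl, hβ.2]
  exact k.2

theorem cyclePerm_apply {β : ℕ →₀ ℕ} {n : ℕ} (hβ : IsPartition β n) (k : Fin n) :
    cyclePerm n β k = (block n β (rowOf β k)).formPerm k := by
  rw [cyclePerm, prod_formPerm_block_apply hβ, if_pos (rowOf_lt_len hβ k)]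

theorem forall_cyclePerm_iff {β : ℕ →₀ ℕ} {n : ℕ} (hβ : IsPartition β n) {γ : Type*}
    (f : Fin n → γ) :
    (∀ k, f (cyclePerm n β k) = f k) ↔ ∀ k l : Fin n, rowOf β k = rowOf β l → f k = f l := by
  constructor
  · intro h
    have key : ∀ j i (hi : i < (block n β j).length),
        f (block n β j)[i] = f ((block n β j)[0]'(by omega)) := by
      intro j i hi
      induction i with
      | zero => rfl
      | succ i ih =>
        rw [← ih (by omega), ← h ((block n β j)[i]), cyclePerm_apply hβ,
          (mem_block_iff hβ).1 (List.getElem_mem (by omega)),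
          List.formPerm_apply_lt_getElem _ (nodup_block n β j) _ hi]
    intro k l hkl
    obtain ⟨i, hi, hk⟩ := List.getElem_of_mem ((mem_block_iff hβ).2 hkl)
    obtain ⟨i', hi', hl⟩ := List.getElem_of_mem ((mem_block_iff hβ (k := l)).2 rfl)
    exact (congrArg f hk).symm.trans
      ((key _ i hi).trans ((key _ i' hi').symm.trans (congrArg f hl)))
  · intro h k
    exact h _ _ (by rw [cyclePerm_apply hβ, rowOf_formPerm_block hβ])

theorem pos_of_lt_len {β : ℕ →₀ ℕ} {n k : ℕ} (hβ : IsPartition β n) (hk : k < len β) :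
    0 < β k := by
  by_contra h
  refine absurd (len_le (γ := β) (l := k) fun i hi => ?_) (not_le.2 hk)
  have := hβ.antitone hi
  omega

theorem card_rowOf_eq {μ : ℕ →₀ ℕ} {n : ℕ} (hμ : IsPartition μ n) (j : ℕ) :
    (Finset.univ.filter fun k : Fin n => rowOf μ k = j).card = μ j := by
  have h1 := card_rowOf_lt hμ j
  have h2 := card_rowOf_lt hμ (j + 1)
  have h3 : (Finset.univ.filter fun k : Fin n => rowOf μ k < j + 1) =
      (Finset.univ.filter fun k : Fin n => rowOf μ k < j) ∪
        (Finset.univ.filter fun k : Fin n => rowOf μ k = j) := by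
    ext k; simp only [Finset.mem_filter, Finset.mem_union, Finset.mem_univ, true_and]; omega
  rw [h3, Finset.card_union_of_disjoint, h1, partialSum_succ] at h2
  · omega
  · rw [Finset.disjoint_filter]; intro k _ h; omega

/-- The product of power sums attached to a partition. -/
noncomputable def psumProd (L : ℕ) (β : ℕ →₀ ℕ) : MvPolynomial (Fin L) ℂ :=
  ∏ j ∈ Finset.range (len β), psum (Fin L) ℂ (β j)

/-- An invariant coloring is a free choice of one color per cycle, and a cycle of length b
contributes the b-th power of its variable. -/
theorem fixPoly_cyclePerm {n L : ℕ} {β : ℕ →₀ ℕ} (hβ : IsPartition β n) :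
    fixPoly L (cyclePerm n β) = psumProd L β := by
  classical
  have hex : ∀ j : Fin (len β), ∃ k : Fin n, rowOf β k = j := fun j =>
    let ⟨k, hk, _⟩ := exists_cell hβ (pos_of_lt_len hβ j.2)
    ⟨k, hk⟩
  choose s hs using hex
  let r : Fin n → Fin (len β) := fun k => ⟨rowOf β k, rowOf_lt_len hβ k⟩
  rw [psumProd, Finset.prod_range]
  simp only [psum]
  rw [Finset.prod_univ_sum, Fintype.piFinset_univ, fixPoly]
  symm
  refine Finset.sum_nbij' (fun h => h ∘ r) (fun f => f ∘ s) ?_ ?_ ?_ ?_ ?_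
  · intro h _
    simp only [Finset.mem_filter, Finset.mem_univ, true_and]
    rw [forall_cyclePerm_iff hβ]
    intro k l hkl
    exact congrArg h (Fin.ext hkl)
  · intro f _; exact Finset.mem_univ _
  · intro h _
    ext j
    exact congrArg (fun i => (h i).val) (Fin.ext (hs j))
  · intro f hf
    simp only [Finset.mem_filter, Finset.mem_univ, true_and] at hf
    rw [forall_cyclePerm_iff hβ] at hf
    funext k
    exact hf _ _ (hs (r k))
  · intro h _
    rw [wt, ← Finset.prod_fiberwise_of_maps_to (g := r) (t := Finset.univ)
      fun _ _ => Finset.mem_univ _]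
    refine Finset.prod_congr rfl fun j _ => ?_
    rw [Finset.prod_congr rfl (g := fun _ => (X (h j) : MvPolynomial (Fin L) ℂ)) fun k hk => by
      rw [Function.comp_apply, (Finset.mem_filter.1 hk).2], Finset.prod_const]
    congr 1
    rw [← card_rowOf_eq hβ]
    congr 1
    ext k
    simp [r, Fin.ext_iff]

/-- The Frobenius character formula. -/
theorem zetaVal_eq_coeff {n L : ℕ} {α β : ℕ →₀ ℕ} (hα : IsPartition α n) (hβ : IsPartition β n)
    (hL : ∀ i, L ≤ i → α i = 0) :
    zetaVal n α β = coeff (shiftExp L α) (vander L * psumProd L β) := by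
  rw [zetaVal, zeta_eq_altCoeff hα hL, altCoeff, fixPoly_cyclePerm hβ]

theorem psumProd_isSymmetric (L : ℕ) (β : ℕ →₀ ℕ) : (psumProd L β).IsSymmetric := by
  intro σ
  rw [psumProd, map_prod]
  exact Finset.prod_congr rfl fun j _ => psum_isSymmetric _ _ _ σ

/-! ### Adding and removing boxes -/

theorem IsPartition.sub_ε {γ : ℕ →₀ ℕ} {n i : ℕ} (hγ : IsPartition γ n) (hi : γ (i + 1) < γ i) :
    IsPartition (γ - ε i) (n - 1) := by
  have hle : ε i ≤ γ := by
    rw [ε, Finsupp.single_le_iff]; omega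
  constructor
  · intro k
    have := hγ.1 k
    simp only [Finsupp.tsub_apply, ε, Finsupp.single_apply]
    split_ifs with h1 h2 h2
    · omega
    · omega
    · subst h2; omega
    · omega
  · have h1 : (γ - ε i + ε i).degree = n := by rw [tsub_add_cancel_of_le hle, hγ.2]
    rw [map_add, ε, Finsupp.degree_single] at h1
    rw [ε]; omega

theorem IsPartition.add_ε {γ : ℕ →₀ ℕ} {n j : ℕ} (hγ : IsPartition γ n)
    (hj : j = 0 ∨ γ j < γ (j - 1)) : IsPartition (γ + ε j) (n + 1) := by
  constructor
  · intro k
    have := hγ.1 k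
    simp only [Finsupp.add_apply, ε, Finsupp.single_apply]
    split_ifs with h1 h2 h2
    · omega
    · subst h1; simp at hj; omega
    · omega
    · omega
  · rw [map_add, hγ.2, ε, Finsupp.degree_single]

theorem len_eq {γ : ℕ →₀ ℕ} {l : ℕ} (h : ∀ k, l ≤ k → γ k = 0) (h' : ∀ k, k < l → γ k ≠ 0) :
    len γ = l := by
  refine le_antisymm (len_le h) ?_
  by_contra hlt
  exact h' _ (not_le.1 hlt) (len_spec γ le_rfl)

/-- If α_i = α_{i+1}, lowering entry i of α + δ makes it equal to entry i+1, and antisymmetry kills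
the coefficient. -/
theorem coeff_X_mul_vander_mul {n L : ℕ} {α : ℕ →₀ ℕ} (hα : IsPartition α n)
    (hL : ∀ i, L ≤ i → α i = 0) {Q : MvPolynomial (Fin L) ℂ} (hQ : Q.IsSymmetric) (i : Fin L) :
    coeff (shiftExp L α) (X i * (vander L * Q)) =
      if α (i + 1) < α i then coeff (shiftExp L (α - ε i)) (vander L * Q) else 0 := by
  classical
  have hrev : ∀ k : Fin L, (k.rev : ℕ) = L - (k + 1) := fun k => Fin.val_rev k
  have hi := i.2
  rw [coeff_X_mul']
  have happ : ∀ k : Fin L, (shiftExp L α - Finsupp.single i 1 : Fin L →₀ ℕ) k =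
      α k + (k.rev : ℕ) - if i = k then 1 else 0 := fun k => by
    rw [Finsupp.tsub_apply, shiftExp_apply, Finsupp.single_apply]
  split_ifs with h1 h2 h2
  · congr 1
    ext k
    rw [happ, shiftExp_apply, Finsupp.tsub_apply, ε, Finsupp.single_apply]
    by_cases hk : i = k
    · subst hk
      rw [if_pos rfl, if_pos rfl]; omega
    · rw [if_neg hk, if_neg fun h => hk (Fin.ext h)]; omega
  · have h3 := hα.1 i
    have h4 : α (i + 1) = α i := by omega
    rw [Finsupp.mem_support_iff, shiftExp_apply, hrev] at h1
    by_cases hL' : (i : ℕ) + 1 < L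
    · refine coeff_vander_mul_eq_zero hQ (i := i) (j := ⟨i + 1, hL'⟩)
        (fun h => by have := congrArg Fin.val h; simp at this) ?_
      rw [happ, happ, if_pos rfl, if_neg fun h => by have := congrArg Fin.val h; simp at this,
        hrev, hrev]
      simp only []
      omega
    -- In the last row, α i = 0 makes the exponent itself 0, so X i cannot divide the monomial.
    · rw [hL (i + 1) (by omega)] at h4
      omega
  · rw [Finsupp.mem_support_iff, not_not, shiftExp_apply] at h1
    omega
  · rfl

theorem sum_removable {L : ℕ} {α : ℕ →₀ ℕ} (hL : ∀ i, L ≤ i → α i = 0) (G : ℕ → ℂ) :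
    ∑ i : Fin L, (if α (i + 1) < α i then G i else 0) = ∑ i ∈ removableRows α, G i := by
  rw [← Finset.sum_range fun i => if α (i + 1) < α i then G i else 0, ← Finset.sum_filter]
  refine Finset.sum_congr ?_ fun _ _ => rfl
  ext i
  simp only [removableRows, Finset.mem_filter, Finset.mem_range, and_congr_left_iff]
  intro h
  constructor
  · intro _
    by_contra h'
    have := len_spec α (not_lt.1 h')
    omega
  · intro _
    by_contra h'
    have := hL i (not_lt.1 h')
    omega

/-- Both parts of the theorem use this: weight 1 for the branching rule, weight α_i - i (rows
counted from 1) for the recursion. -/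
theorem sum_mul_coeff_X_mul {n L : ℕ} {α β : ℕ →₀ ℕ} (hα : IsPartition α n)
    (hβ : IsPartition β (n - 1)) (hL : ∀ i, L ≤ i → α i = 0) (c : ℕ → ℂ) :
    ∑ i : Fin L, c i * coeff (shiftExp L α) (X i * (vander L * psumProd L β)) =
      ∑ i ∈ removableRows α, c i * zetaVal (n - 1) (α - ε i) β := by
  rw [← sum_removable hL]
  refine Finset.sum_congr rfl fun i _ => ?_
  rw [coeff_X_mul_vander_mul hα hL (psumProd_isSymmetric L β)]
  split_ifs with h
  · rw [zetaVal_eq_coeff (hα.sub_ε h) hβ fun k hk => by simp [hL k hk]]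
  · rw [mul_zero]

theorem coeff_X_mul_euler {L : ℕ} (i : Fin L) (a : Fin L →₀ ℕ) (F : MvPolynomial (Fin L) ℂ) :
    coeff a (X i * euler i F) = ((a i : ℂ) - 1) * coeff a (X i * F) := by
  classical
  rw [coeff_X_mul', coeff_X_mul']
  split_ifs with h
  · rw [coeff_euler, Finsupp.tsub_apply, Finsupp.single_eq_same,
      Nat.cast_sub (Nat.one_le_iff_ne_zero.2 (Finsupp.mem_support_iff.1 h)), Nat.cast_one]
  · rw [mul_zero]

theorem sum_X_mul_euler_psum (L b : ℕ) :
    ∑ i, X i * euler i (psum (Fin L) ℂ b) = (b : ℂ) • psum (Fin L) ℂ (b + 1) := by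
  rw [psum, psum, Finset.smul_sum]
  refine Finset.sum_congr rfl fun i _ => ?_
  rw [map_sum, Finset.sum_eq_single i]
  · rw [Derivation.leibniz_pow, euler_X, if_pos rfl, ← Nat.cast_smul_eq_nsmul ℂ, mul_smul_comm,
      smul_eq_mul]
    rcases b with _ | b
    · simp
    · rw [Nat.add_sub_cancel]; congr 1; ring
  · intro k _ hk
    rw [Derivation.leibniz_pow, euler_X, if_neg hk]; simp
  · simp

/-- The product of power sums in which the exponent number `j` is raised by one. -/
noncomputable def raisedProd (L m : ℕ) (γ : ℕ →₀ ℕ) (j : ℕ) : MvPolynomial (Fin L) ℂ :=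
  (∏ k ∈ (Finset.range m).erase j, psum (Fin L) ℂ (γ k)) * psum (Fin L) ℂ (γ j + 1)

theorem raisedProd_eq_prod {L m j : ℕ} {γ δ : ℕ →₀ ℕ} (hj : j < m)
    (hδ : ∀ k, k < m → δ k = γ k + if k = j then 1 else 0) :
    raisedProd L m γ j = ∏ k ∈ Finset.range m, psum (Fin L) ℂ (δ k) := by
  rw [raisedProd, ← Finset.prod_erase_mul _ _ (Finset.mem_range.2 hj), hδ j hj, if_pos rfl]
  congr 1
  refine Finset.prod_congr rfl fun k hk => ?_
  rw [Finset.mem_erase, Finset.mem_range] at hk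
  rw [hδ k hk.2, if_neg hk.1, add_zero]

theorem raisedProd_congr {L m j k : ℕ} {γ : ℕ →₀ ℕ} (hj : j < m) (hk : k < m) (h : γ j = γ k) :
    raisedProd L m γ j = raisedProd L m γ k := by
  rw [raisedProd, raisedProd, h]
  congr 1
  have hval : ∀ i, γ (Equiv.swap j k i) = γ i := fun i => by
    rw [Equiv.swap_apply_def]
    split_ifs with h1 h2
    · rw [h1, h]
    · rw [h2, h]
    · rfl
  have hlt : ∀ i, i < m → Equiv.swap j k i < m := fun i hi => by
    rw [Equiv.swap_apply_def]
    split_ifs <;> assumption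
  refine Finset.prod_nbij' (Equiv.swap j k) (Equiv.swap j k) ?_ ?_ ?_ ?_ ?_
  · intro i hi
    rw [Finset.mem_erase, Finset.mem_range] at hi ⊢
    exact ⟨fun h' => hi.1 (by rw [Equiv.swap_apply_eq_iff, Equiv.swap_apply_right] at h'; exact h'),
      hlt i hi.2⟩
  · intro i hi
    rw [Finset.mem_erase, Finset.mem_range] at hi ⊢
    exact ⟨fun h' => hi.1 (by rw [Equiv.swap_apply_eq_iff, Equiv.swap_apply_left] at h'; exact h'),
      hlt i hi.2⟩
  · intro i _; simp
  · intro i _; simp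
  · intro i _; rw [hval]

theorem sum_X_mul_euler_psumProd (L : ℕ) (γ : ℕ →₀ ℕ) :
    ∑ i, X i * euler i (psumProd L γ) =
      ∑ j ∈ Finset.range (len γ), (γ j : ℂ) • raisedProd L (len γ) γ j := by
  simp only [psumProd, derivation_prod, Finset.mul_sum]
  rw [Finset.sum_comm]
  refine Finset.sum_congr rfl fun j _ => ?_
  rw [raisedProd, ← mul_smul_comm, ← sum_X_mul_euler_psum, Finset.mul_sum]
  exact Finset.sum_congr rfl fun i _ => mul_left_comm _ _ _

/-- The constant L collects 1 from the shift by X i before the Euler operator is read off, and L-1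
from the derivation acting on the Vandermonde product. -/
theorem vander_mul_sum_X_mul_euler {L : ℕ} (Q : MvPolynomial (Fin L) ℂ) (a : Fin L →₀ ℕ) :
    coeff a (vander L * ∑ i, X i * euler i Q) =
      ∑ i, ((a i : ℂ) - L) * coeff a (X i * (vander L * Q)) := by
  have h : vander L * ∑ i, X i * euler i Q = ∑ i, (X i * euler i (vander L * Q) -
      ((L : ℂ) - 1) • (X i * (vander L * Q))) := by
    have h1 : ∑ i, X i * euler i (vander L * Q) =
        vander L * ∑ i, X i * euler i Q + (∑ i, X i * euler i (vander L)) * Q := by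
      rw [Finset.mul_sum, Finset.sum_mul, ← Finset.sum_add_distrib]
      refine Finset.sum_congr rfl fun i _ => ?_
      rw [Derivation.leibniz, smul_eq_mul, smul_eq_mul]; ring
    rw [Finset.sum_sub_distrib, h1, sum_X_mul_euler_vander, ← Finset.smul_sum, ← Finset.sum_mul]
    simp only [psum, pow_one, smul_mul_assoc, mul_assoc, add_sub_cancel_right]
  rw [h, coeff_sum]
  refine Finset.sum_congr rfl fun i _ => ?_
  rw [coeff_sub, coeff_smul, coeff_X_mul_euler, smul_eq_mul]; ring

/-- Equal entries of an antitone sequence form runs; the descents, with position 0, are the first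
positions of the runs. -/
theorem sum_range_eq_sum_descents {γ : ℕ → ℕ} (hγ : Antitone γ) (M : ℕ) (t : ℕ → ℂ)
    (ht : ∀ j < M, ∀ k < M, γ j = γ k → t j = t k) :
    ∑ k ∈ Finset.range M, t k =
      ∑ j ∈ (Finset.range M).filter (fun j => j = 0 ∨ γ j < γ (j - 1)),
        (((Finset.range M).filter fun k => γ k = γ j).card : ℂ) * t j := by
  have h1 : ∀ j ∈ (Finset.range M).filter (fun j => j = 0 ∨ γ j < γ (j - 1)),
      (((Finset.range M).filter fun k => γ k = γ j).card : ℂ) * t j =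
        ∑ k ∈ Finset.range M, if γ k = γ j then t k else 0 := by
    intro j hj
    rw [Finset.mem_filter, Finset.mem_range] at hj
    rw [← nsmul_eq_mul, ← Finset.sum_const, Finset.sum_filter]
    refine Finset.sum_congr rfl fun k hk => ?_
    split_ifs with h
    · exact (ht k (Finset.mem_range.1 hk) j hj.1 h).symm
    · rfl
  rw [Finset.sum_congr rfl h1, Finset.sum_comm]
  refine Finset.sum_congr rfl fun k hk => ?_
  rw [Finset.mem_range] at hk
  have hex : ∃ j, γ k = γ j := ⟨k, rfl⟩
  have hj := Nat.find_spec hex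
  have hjk : Nat.find hex ≤ k := Nat.find_min' hex rfl
  have hdesc : Nat.find hex = 0 ∨ γ (Nat.find hex) < γ (Nat.find hex - 1) := by
    rcases Nat.eq_zero_or_pos (Nat.find hex) with h0 | h0
    · exact Or.inl h0
    · refine Or.inr (lt_of_le_of_ne (hγ (Nat.sub_le _ _)) fun h => ?_)
      exact Nat.find_min hex (Nat.sub_lt h0 one_pos) (hj.trans h)
  rw [Finset.sum_eq_single_of_mem (Nat.find hex)
    (Finset.mem_filter.2 ⟨Finset.mem_range.2 (by omega), hdesc⟩), if_pos hj]
  intro j hj' hne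
  rw [Finset.mem_filter, Finset.mem_range] at hj'
  rw [if_neg]
  intro h
  have h2 : Nat.find hex < j := lt_of_le_of_ne (Nat.find_min' hex h) (Ne.symm hne)
  rcases hj'.2 with h3 | h3
  · omega
  · have := hγ (show Nat.find hex ≤ j - 1 by omega)
    omega

end SymChar

/-! ### The branching rule and the recursion -/

theorem theorem4p5 (n : ℕ) (hn : 0 < n) (α β : ℕ →₀ ℕ)
    (hα : SymChar.IsPartition α n) (hβ : SymChar.IsPartition β n)
    (m : ℕ) (hm : m = SymChar.len β) :
    (β (m - 1) = 1 →
      SymChar.zetaVal n α β =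
        ∑ i ∈ SymChar.removableRows α,
          SymChar.zetaVal (n - 1) (α - SymChar.ε i) (β - SymChar.ε (m - 1))) ∧
    (β (m - 1) ≠ 1 →
      SymChar.zetaVal n α β =
        ((β (m - 1) : ℂ) - 1)⁻¹ *
          (∑ i ∈ SymChar.removableRows α,
              ((α i : ℂ) - ((i : ℂ) + 1)) *
                SymChar.zetaVal (n - 1) (α - SymChar.ε i) (β - SymChar.ε (m - 1)) -
            ∑ j ∈ SymChar.descentsBeforeLast β,
              (SymChar.mult (β - SymChar.ε (m - 1)) j : ℂ) * (β j : ℂ) *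
                SymChar.zetaVal n α (β + SymChar.ε j - SymChar.ε (m - 1)))) := by
  open SymChar MvPolynomial in
  have hpos : 0 < m := by
    rw [hm]
    by_contra h
    have h1 := partialSum_eq_of_len_le (γ := β) (j := 0) (by omega)
    rw [hβ.2] at h1
    simp [partialSum] at h1
    omega
  have hβz : ∀ k, m ≤ k → β k = 0 := fun k hk => len_spec β (hm ▸ hk)
  have hβp : ∀ k, k < m → 0 < β k := fun k hk => pos_of_lt_len hβ (hm ▸ hk)
  have hlast := hβp (m - 1) (by omega)
  have hβ' : IsPartition (β - ε (m - 1)) (n - 1) := hβ.sub_ε (by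
    rw [Nat.sub_add_cancel hpos, hβz m le_rfl]; exact hlast)
  have happ : ∀ k, (β - ε (m - 1)) k = β k - if m - 1 = k then 1 else 0 := fun k => by
    rw [Finsupp.tsub_apply, ε, Finsupp.single_apply]
  have hLα : ∀ i, len α ≤ i → α i = 0 := fun i hi => len_spec α hi
  have hβanti := hβ.antitone
  constructor
  · intro h1
    have hlen : len (β - ε (m - 1)) = m - 1 := len_eq
      (fun k hk => by
        rw [happ]
        split_ifs with h
        · rw [← h, h1]
        · rw [hβz k (by omega)])
      (fun k hk => by
        have := hβp k (by omega)
        rw [happ, if_neg (by omega)]; omega)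
    have hprod : psumProd (len α) β =
        psum (Fin (len α)) ℂ 1 * psumProd (len α) (β - ε (m - 1)) := by
      rw [psumProd, psumProd, hlen, ← hm, ← Nat.sub_add_cancel hpos, Finset.prod_range_succ,
        Nat.add_sub_cancel, h1, mul_comm]
      congr 1
      refine Finset.prod_congr rfl fun k hk => ?_
      rw [Finset.mem_range] at hk
      rw [happ, if_neg (by omega), Nat.sub_zero]
    rw [zetaVal_eq_coeff hα hβ hLα, hprod, mul_left_comm, psum, Finset.sum_mul, coeff_sum]
    have := sum_mul_coeff_X_mul hα hβ' hLα fun _ => 1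
    simpa using this
  · intro h1
    -- Here the last part is at least 2, so it survives the subtraction.
    have hlen : len (β - ε (m - 1)) = m := len_eq
      (fun k hk => by rw [happ, hβz k hk, Nat.zero_sub])
      (fun k hk => by
        have := hβp k hk
        rw [happ]
        split_ifs with h
        · subst h; omega
        · omega)
    set C : ℕ → ℂ := fun j => coeff (shiftExp (len α) α)
      (vander (len α) * raisedProd (len α) m (β - ε (m - 1)) j) with hC
    -- The same coefficient of Δ · D p_γ, with γ = β - ε_m, is computed in two ways.
    have hmain : ∑ j ∈ Finset.range m, ((β - ε (m - 1)) j : ℂ) * C j =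
        ∑ i ∈ removableRows α, ((α i : ℂ) - ((i : ℂ) + 1)) *
          zetaVal (n - 1) (α - ε i) (β - ε (m - 1)) := by
      rw [← sum_mul_coeff_X_mul hα hβ' hLα fun i => (α i : ℂ) - ((i : ℂ) + 1)]
      have h2 := vander_mul_sum_X_mul_euler (psumProd (len α) (β - ε (m - 1)))
        (shiftExp (len α) α)
      rw [sum_X_mul_euler_psumProd, hlen, Finset.mul_sum, coeff_sum] at h2
      simp only [mul_smul_comm, coeff_smul, smul_eq_mul] at h2
      rw [h2]
      refine Finset.sum_congr rfl fun i _ => ?_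
      -- With i counted from 0, the entry of α + δ minus L is α i + (L - (i + 1)) - L.
      rw [shiftExp_apply, Fin.val_rev, Nat.cast_add, Nat.cast_sub i.2]
      push_cast
      ring
    have hCβ : C (m - 1) = zetaVal n α β := by
      rw [hC, zetaVal_eq_coeff hα hβ hLα, psumProd, ← hm]
      dsimp only
      rw [raisedProd_eq_prod (δ := β) (by omega)]
      intro k hk
      have := hβp k hk
      rw [happ]
      by_cases h : m - 1 = k
      · rw [if_pos h, if_pos h.symm]; omega
      · rw [if_neg h, if_neg (Ne.symm h)]; omega
    have hCj : ∀ j ∈ descentsBeforeLast β,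
        zetaVal n α (β + ε j - ε (m - 1)) = C j := by
      intro j hj
      rw [descentsBeforeLast, Finset.mem_filter, Finset.mem_range, ← hm] at hj
      -- The last part is positive, so truncated subtraction commutes with the addition.
      have heq : β + ε j - ε (m - 1) = β - ε (m - 1) + ε j := by
        ext k
        have := hβp (m - 1) (by omega)
        simp only [Finsupp.tsub_apply, Finsupp.add_apply, ε, Finsupp.single_apply]
        split_ifs with h2 h3 h3
        · omega
        · omega
        · subst h3; omega
        · omega
      have hP : IsPartition (β - ε (m - 1) + ε j) n := by
        have := hβ'.add_ε (j := j) (by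
          rw [happ, happ, if_neg (by omega), if_neg (by omega)]
          exact hj.2)
        rwa [Nat.sub_add_cancel hn] at this
      have happ2 : ∀ k, (β - ε (m - 1) + ε j) k = (β - ε (m - 1)) k + if k = j then 1 else 0 :=
        fun k => by
          rw [Finsupp.add_apply, ε, ε, Finsupp.single_apply (a := j)]
          simp only [eq_comm]
      have hlen2 : len (β - ε (m - 1) + ε j) = m := len_eq
        (fun k hk => by rw [happ2, if_neg (by omega), len_spec _ (hlen.trans_le hk)])
        (fun k hk => by
          have := pos_of_lt_len hβ' (hk.trans_eq hlen.symm)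
          rw [happ2]; omega)
      rw [heq, zetaVal_eq_coeff hα hP hLα, psumProd, hlen2, hC]
      dsimp only
      rw [raisedProd_eq_prod (by omega) fun k _ => happ2 k]
    -- The last position never counts: its lowered entry is smaller than every β j.
    have hmult : ∀ j ∈ descentsBeforeLast β, mult (β - ε (m - 1)) j =
        ((Finset.range (m - 1)).filter fun k => β k = β j).card := by
      intro j hj
      rw [descentsBeforeLast, Finset.mem_filter, Finset.mem_range, ← hm] at hj
      rw [mult, hlen]
      congr 1
      ext k
      have h2 := hβanti (show j ≤ m - 1 by omega)
      rw [Finset.mem_filter, Finset.mem_filter, Finset.mem_range, Finset.mem_range, happ, happ,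
        if_neg (show ¬ m - 1 = j by omega)]
      by_cases h : m - 1 = k
      · subst h
        rw [if_pos rfl]; omega
      · rw [if_neg h]; omega
    -- Before the last position β and β - ε_m agree, so equal parts of β yield equal values C j.
    have hgroup := sum_range_eq_sum_descents hβanti (m - 1) (fun j => (β j : ℂ) * C j)
      (fun j hj k hk h => by
        have hv : (β - ε (m - 1)) j = (β - ε (m - 1)) k := by
          rw [happ, happ, if_neg (by omega), if_neg (by omega), h]
        simp only [hC, h]
        rw [raisedProd_congr (by omega) (by omega) hv])
    have hsplit : ∑ j ∈ Finset.range m, ((β - ε (m - 1)) j : ℂ) * C j =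
        ∑ j ∈ Finset.range (m - 1), (β j : ℂ) * C j +
          ((β (m - 1) : ℂ) - 1) * zetaVal n α β := by
      rw [← hCβ]
      conv_lhs => rw [← Nat.sub_add_cancel hpos, Finset.sum_range_succ, Nat.sub_add_cancel hpos]
      congr 1
      · refine Finset.sum_congr rfl fun k hk => ?_
        rw [Finset.mem_range] at hk
        rw [happ, if_neg (by omega), Nat.sub_zero]
      · rw [happ, if_pos rfl, Nat.cast_sub hlast, Nat.cast_one]
    have hdesc : ∑ j ∈ descentsBeforeLast β, (mult (β - ε (m - 1)) j : ℂ) * (β j : ℂ) *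
        zetaVal n α (β + ε j - ε (m - 1)) = ∑ j ∈ Finset.range (m - 1), (β j : ℂ) * C j := by
      rw [hgroup, descentsBeforeLast, ← hm]
      refine Finset.sum_congr rfl fun j hj => ?_
      have hj' : j ∈ descentsBeforeLast β := by rw [descentsBeforeLast, ← hm]; exact hj
      rw [hmult j hj', hCj j hj', mul_assoc]
    rw [hdesc, ← hmain, hsplit, add_sub_cancel_left, ← mul_assoc, inv_mul_cancel₀, one_mul]
    rw [sub_ne_zero]
    exact_mod_cast h1
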